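/- Let $\mathbb{H}^2=\{z=x+iy\in\mathbb{C}: y>0\}$, let $w=u+iv$ be the coordinate of $\mathbb{C}$, and let $k>0$. Put $f(t)=-kt$ for $t\ge 0$, and let $\mathbf{g}_f$ be the pseudo-Riemannian metric on $\mathbb{H}^2\times\mathbb{C}$ whose matrix in the frame $\partial_x,\partial_y,\partial_u,\partial_v$ is $$\begin{pmatrix}\frac1{y^2}\bigl(1-f+3(u^2+v^2)y^3f'\bigr)&0&2f'vy^2&-2f'uy^2\\0&\frac1{y^2}\bigl(1-f+3(u^2+v^2)y^3f'\bigr)&2f'uy^2&2f'vy^2\\2f'vy^2&2f'uy^2&\frac43f'y^3&0\\-2f'uy^2&2f'vy^2&0&\frac43f'y^3\end{pmatrix},$$ with $f,f'$ evaluated at $y^3(u^2+v^2)$. An isometry is a smooth diffeomorphism $h$ of $\mathbb{H}^2\times\mathbb{C}$ with $h^*\mathbf{g}_f=\mathbf{g}_f$; the set $\mathrm{Isom}$ of all isometries carries the compact-open topology. A matrix $P=\begin{pmatrix}a&b\\c&d\end{pmatrix}\in \mathrm{SL}(2,\mathbb{R})$ acts by $P(z,w)=\bigl(\frac{az+b}{cz+d},(cz+d)^3w\bigr)$,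 and $e^{i\theta}$ acts by $e^{i\theta}(z,w)=(z,e^{i\theta}w)$. Let $h_1(z,w)=(-\bar z,w)$ and $h_2(z,w)=(z,\bar w)$. Then every isometry $h$ can be written in one, and only one, of the four forms $$h=P\circ e^{i\theta},\qquad h=P\circ e^{i\theta}\circ h_1,\qquad h=P\circ e^{i\theta}\circ h_2,\qquad h=P\circ e^{i\theta}\circ h_1\circ h_2,$$ with $P\in\mathrm{SL}(2,\mathbb{R})$ and $\theta\in\mathbb{R}$. Which form occurs is determined by the connected component of $h$ in $\mathrm{Isom}$: an isometry has the first form if and only if it lies in the connected component of the identity, and two isometries lie in the same connected component if and only if they have the same form. (It is not asserted that every one of the four forms occurs.) -/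

import Mathlib

open scoped Manifold ContDiff Matrix UpperHalfPlane MatrixGroups

noncomputable section

namespace TorusCubic

/-- The space `ℍ² × ℂ`, with global coordinates `z = x + i y` and `w = u + i v`. -/
abbrev Total : Type := ℍ × ℂ

/-- The real model with corners of the smooth four-manifold `ℍ² × ℂ`. The chart of `ℍ` is the
inclusion into `ℂ`, so a tangent vector is a pair of complex numbers, `(dz, dw)`. -/
abbrev model := 𝓘(ℝ, ℂ).prod 𝓘(ℝ, ℂ)

instance : IsManifold 𝓘(ℝ, ℂ) ∞ ℍ :=
  UpperHalfPlane.isOpenEmbedding_coe.isManifold_singleton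

/-- The components of the tangent vector `(dz, dw)` in the basis `∂/∂x, ∂/∂y, ∂/∂u, ∂/∂v`. -/
def coords (X : ℂ × ℂ) : Fin 4 → ℝ := ![X.1.re, X.1.im, X.2.re, X.2.im]

/-- The matrix of `g_f` at a point, in the basis `∂/∂x, ∂/∂y, ∂/∂u, ∂/∂v`; the function `f` on
`[0, ∞)` and its derivative are evaluated at `y ^ 3 * (u ^ 2 + v ^ 2)`. -/
def metricMatrix (f : ℝ → ℝ) (p : Total) : Matrix (Fin 4) (Fin 4) ℝ :=
  let y : ℝ := p.1.im
  let u : ℝ := p.2.re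
  let v : ℝ := p.2.im
  let t : ℝ := y ^ 3 * (u ^ 2 + v ^ 2)
  let F : ℝ := f t
  let F' : ℝ := derivWithin f (Set.Ici 0) t
  !![1 / y ^ 2 * (1 - F + 3 * (u ^ 2 + v ^ 2) * y ^ 3 * F'), 0,
        2 * F' * v * y ^ 2, -(2 * F' * u * y ^ 2);
     0, 1 / y ^ 2 * (1 - F + 3 * (u ^ 2 + v ^ 2) * y ^ 3 * F'),
        2 * F' * u * y ^ 2, 2 * F' * v * y ^ 2;
     2 * F' * v * y ^ 2, 2 * F' * u * y ^ 2, 4 / 3 * F' * y ^ 3, 0;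
     -(2 * F' * u * y ^ 2), 2 * F' * v * y ^ 2, 0, 4 / 3 * F' * y ^ 3]

/-- The pseudo-Riemannian metric `g_f`. -/
def metric (f : ℝ → ℝ) (p : Total) (X Y : TangentSpace model p) : ℝ :=
  coords X ⬝ᵥ (metricMatrix f p *ᵥ coords Y)

/-- The isometries of `(ℍ² × ℂ, g_f)`: the smooth diffeomorphisms `h` with `h^* g_f = g_f`. -/
def Isom (f : ℝ → ℝ) : Type :=
  {h : Diffeomorph model model Total Total ∞ //
    ∀ (p : Total) (X Y : TangentSpace model p),
      metric f (h p) (mfderiv model model h p X) (mfderiv model model h p Y) = metric f p X Y}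

namespace Isom

variable {f : ℝ → ℝ}

instance : CoeFun (Isom f) (fun _ => Total → Total) := ⟨fun h => h.1⟩

/-- An isometry as a continuous map. -/
def toContinuousMap (h : Isom f) : C(Total, Total) := ⟨h, h.1.continuous⟩

/-- The isometry group carries the compact-open topology. -/
instance : TopologicalSpace (Isom f) :=
  TopologicalSpace.induced toContinuousMap inferInstance

/-- The identity isometry. -/
protected def id (f : ℝ → ℝ) : Isom f :=
  ⟨Diffeomorph.refl model Total ∞, fun p X Y => by
    rw [Diffeomorph.coe_refl, mfderiv_id]
    rfl⟩

end Isom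

/-- The action of a matrix in `SL(2, ℝ)` with rows `(a, b)` and `(c, d)`:
`(z, w) ↦ ((a z + b) / (c z + d), (c z + d) ^ 3 w)`. -/
def slAct (P : SL(2, ℝ)) (p : Total) : Total :=
  (P • p.1, (((P 1 0 : ℝ) : ℂ) * (p.1 : ℂ) + ((P 1 1 : ℝ) : ℂ)) ^ 3 * p.2)

/-- The circle action `(z, w) ↦ (z, e^{iθ} w)`. -/
def rot (θ : ℝ) (p : Total) : Total := (p.1, Complex.exp (θ * Complex.I) * p.2)

/-- The reflection `h₁ (z, w) = (-z̄, w)`. -/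
def refl₁ (p : Total) : Total :=
  (⟨-(starRingEnd ℂ) (p.1 : ℂ), by simpa using p.1.im_pos⟩, p.2)

/-- The reflection `h₂ (z, w) = (z, w̄)`. -/
def refl₂ (p : Total) : Total := (p.1, (starRingEnd ℂ) p.2)

/-- The map `h` can be written as `P ∘ e^{iθ} ∘ r`. -/
def HasForm (r h : Total → Total) : Prop :=
  ∃ (P : SL(2, ℝ)) (θ : ℝ), h = slAct P ∘ rot θ ∘ r

end TorusCubic

end

/-! For f(t) = -kt the metric is the real part of a Hermitian form `herm` of signature (1,1). It has
a hyperbolic part scaled by 1 + kt, where t = y³|w|², minus a multiple of y³|vert|², where `vert` is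
the vertical part of a tangent vector for the Chern connection of the line bundle with fibre norm
y³|w|². The complex bilinear symbols `christoffel` are symmetric and compatible with the form, so
the metric is pseudo-Kähler and they give its Levi-Civita connection.

An isometry is affine for this connection, hence preserves the curvature and the Ricci endomorphism.
The scalar curvature is 4/(1 + kt), an injective function of t, so t is preserved
(`realLevel_comp`). The gradient of t is a constant multiple of the Euler field (0, w) of the
fibres, so the Euler field is preserved too. Along the rays of a fibre this forces an isometry to
map fibres real-linearly to fibres and the zero section to itself (`fderiv_zeroSection`).

The induced map of the half-plane preserves the hyperbolic metric, so it is holomorphic or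
antiholomorphic. In the first case, composing with an element of SL(2, ℝ) gives it the 1-jet of the
identity at i, and the Schwarz lemma makes it the identity. Over the identity the fibre maps cannot
be antilinear, because the bundle is curved (`not_antilinear`); if linear they are one constant
rotation (`eq_rotMap`). The antiholomorphic case reduces to this by the isometry (z, w) ↦ (-z̄, w̄).
So only the first and last forms occur (`Isom.hasForm_or`).

Any two isometries of the same form are joined through the connected family P ∘ e^{iθ}. The two
occurring forms are separated by the sign of a continuous nonvanishing function, the orientation on
the fibre over i. -/

noncomputable section

namespace TorusCubic

open Complex ComplexConjugate

/-! ### The Hermitian form and its connection -/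

/-- The invariant `t = y ^ 3 |w| ^ 2`. -/
def level (p : ℂ × ℂ) : ℂ := (p.1.im : ℂ) ^ 3 * (p.2 * conj p.2)

/-- The vertical component of a tangent vector for the Chern connection of the line bundle. -/
def vert (p X : ℂ × ℂ) : ℂ := X.2 - 3 * I / (2 * (p.1.im : ℂ)) * p.2 * X.1

/-- The Hermitian form whose real part is the metric `g_f` for `f t = -k t`. -/
def herm (k : ℝ) (p X Y : ℂ × ℂ) : ℂ :=
  (1 + k * level p) / (p.1.im : ℂ) ^ 2 * (X.1 * conj Y.1) -
    4 / 3 * k * (p.1.im : ℂ) ^ 3 * (vert p X * conj (vert p Y))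

/-- The symmetric form through which the fibre coordinates enter the Christoffel symbols. -/
def mixed (p X Y : ℂ × ℂ) : ℂ :=
  X.1 * Y.2 + X.2 * Y.1 - 3 * I / (p.1.im : ℂ) * p.2 * (X.1 * Y.1)

/-- The Christoffel symbols of the Chern (= Levi-Civita) connection of `herm`. -/
def christoffel (k : ℝ) (p X Y : ℂ × ℂ) : ℂ × ℂ :=
  (k * (p.1.im : ℂ) ^ 3 * conj p.2 / (1 + k * level p) * mixed p X Y +
      I / (p.1.im : ℂ) * (X.1 * Y.1),
    -(3 * I / (2 * (p.1.im : ℂ))) / (1 + k * level p) * mixed p X Y +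
      3 / (2 * (p.1.im : ℂ) ^ 2) * p.2 * (X.1 * Y.1))

lemma level_eq_ofReal (p : ℂ × ℂ) : level p = ((p.1.im ^ 3 * normSq p.2 : ℝ) : ℂ) := by
  simp [level, mul_conj]

/-- Since k > 0 and t ≥ 0, the denominators of the connection and of the curvature never vanish. -/
lemma one_add_mul_level_ne_zero {k : ℝ} (hk : 0 < k) {p : ℂ × ℂ} (hp : 0 < p.1.im) :
    1 + k * level p ≠ 0 := by
  rw [level_eq_ofReal]
  have : 0 < 1 + k * (p.1.im ^ 3 * normSq p.2) := by
    have := normSq_nonneg p.2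
    positivity
  exact_mod_cast this.ne'

section Curves

variable {P X Y : ℝ → ℂ × ℂ} {P' X' Y' : ℂ × ℂ} {s : ℝ}

lemma _root_.HasDerivAt.fst_comp (h : HasDerivAt X X' s) : HasDerivAt (fun s => (X s).1) X'.1 s :=
  (hasFDerivAt_fst (𝕜 := ℝ) (p := X s)).comp_hasDerivAt s h

lemma _root_.HasDerivAt.snd_comp (h : HasDerivAt X X' s) : HasDerivAt (fun s => (X s).2) X'.2 s :=
  (hasFDerivAt_snd (𝕜 := ℝ) (p := X s)).comp_hasDerivAt s h

lemma _root_.HasDerivAt.conj_comp {f : ℝ → ℂ} {f' : ℂ} (h : HasDerivAt f f' s) :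
    HasDerivAt (fun s => conj (f s)) (conj f') s :=
  (conjCLE : ℂ →L[ℝ] ℂ).hasFDerivAt.comp_hasDerivAt s h

lemma _root_.HasDerivAt.ofReal_im_comp {f : ℝ → ℂ} {f' : ℂ} (h : HasDerivAt f f' s) :
    HasDerivAt (fun s => ((f s).im : ℂ)) (f'.im : ℂ) s :=
  (imCLM.hasFDerivAt.comp_hasDerivAt s h).ofReal_comp

lemma hasDerivAt_level (hP : HasDerivAt P P' s) :
    HasDerivAt (fun s => level (P s))
      (3 * ((P s).1.im : ℂ) ^ 2 * P'.1.im * ((P s).2 * conj (P s).2) +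
        ((P s).1.im : ℂ) ^ 3 * (P'.2 * conj (P s).2 + (P s).2 * conj P'.2)) s := by
  have hy := hP.fst_comp.ofReal_im_comp
  have hw := hP.snd_comp
  refine ((hy.pow 3).mul (hw.mul hw.conj_comp)).congr_deriv ?_
  simp

lemma hasDerivAt_vert (hP : HasDerivAt P P' s) (hX : HasDerivAt X X' s) (hp : 0 < (P s).1.im) :
    HasDerivAt (fun s => vert (P s) (X s))
      (vert (P s) X' - 3 * I / (2 * ((P s).1.im : ℂ)) * P'.2 * (X s).1 +
        3 * I * P'.1.im / (2 * ((P s).1.im : ℂ) ^ 2) * (P s).2 * (X s).1) s := by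
  have hy := hP.fst_comp.ofReal_im_comp
  have hw := hP.snd_comp
  have h0 : ((P s).1.im : ℂ) ≠ 0 := by exact_mod_cast hp.ne'
  refine (hX.snd_comp.sub ((((hasDerivAt_const s (3 * I)).div (hy.const_mul 2)
    (by simpa using h0)).mul hw).mul hX.fst_comp)).congr_deriv ?_
  simp only [vert, Pi.div_apply, Pi.mul_apply]
  field_simp
  ring

/-- Compatibility of the connection with the Hermitian form, along curves. -/
lemma hasDerivAt_herm {k : ℝ} (hk : 0 < k) (hP : HasDerivAt P P' s) (hX : HasDerivAt X X' s)
    (hY : HasDerivAt Y Y' s) (hp : 0 < (P s).1.im) :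
    HasDerivAt (fun s => herm k (P s) (X s) (Y s))
      (herm k (P s) (X' + christoffel k (P s) P' (X s)) (Y s) +
        herm k (P s) (X s) (Y' + christoffel k (P s) P' (Y s))) s := by
  have hy := hP.fst_comp.ofReal_im_comp
  have h0 : ((P s).1.im : ℂ) ≠ 0 := by exact_mod_cast hp.ne'
  have hn := one_add_mul_level_ne_zero hk hp
  refine (((((hasDerivAt_level hP).const_mul (k : ℂ)).const_add 1).div (hy.pow 2)
    (pow_ne_zero 2 h0)).mul (hX.fst_comp.mul hY.fst_comp.conj_comp) |>.sub
    (((hy.pow 3).const_mul (4 / 3 * (k : ℂ))).mul ((hasDerivAt_vert hP hX hp).mul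
    (hasDerivAt_vert hP hY hp).conj_comp))).congr_deriv ?_
  have hI : I ^ 2 = -1 := I_sq
  simp only [Pi.mul_apply, Pi.div_apply, Pi.pow_apply, herm, christoffel]
  have hn' : level (P s) = ((P s).1.im : ℂ) ^ 3 * ((P s).2 * conj (P s).2) := rfl
  have hnc : conj (level (P s)) = level (P s) := by rw [level_eq_ofReal, conj_ofReal]
  simp only [vert, mixed, map_add, map_sub, map_mul, map_div₀, map_neg, conj_I, conj_ofReal,
    conj_conj, map_pow, map_ofNat, Prod.fst_add, Prod.snd_add, map_one, hnc]
  rw [im_eq_sub_conj P'.1]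
  clear hy hP hX hY hnc
  -- What remains is an identity of rational functions in the components and their conjugates,
  -- treated as independent variables; the relations used are I² = -1 and t = y³ w w̄.
  generalize level (P s) = t at *
  generalize ((P s).1.im : ℂ) = y at *
  generalize (P s).2 = w at *
  generalize conj w = wb at *
  generalize P'.1 = z at *
  generalize conj z = zb at *
  generalize P'.2 = v at *
  generalize conj v = vb at *
  generalize (X s).1 = X1 at *
  generalize (Y s).1 = Y1 at *
  generalize (X s).2 = X2 at *
  generalize (Y s).2 = Y2 at *
  generalize conj X1 = X1b at *
  generalize conj Y1 = Y1b at *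
  generalize conj X2 = X2b at *
  generalize conj Y2 = Y2b at *
  generalize X'.1 = V1 at *
  generalize Y'.1 = W1 at *
  generalize X'.2 = V2 at *
  generalize Y'.2 = W2 at *
  generalize conj V1 = V1b at *
  generalize conj W1 = W1b at *
  generalize conj V2 = V2b at *
  generalize conj W2 = W2b at *
  generalize (k : ℂ) = κ at *
  obtain ⟨n, hnt⟩ : ∃ n, n = 1 + κ * t := ⟨_, rfl⟩
  rw [← hnt] at hn ⊢
  field_simp
  subst hnt hn'
  rw [← sub_eq_zero]
  grind

end Curves

/-! ### Derivatives of the Christoffel symbols and curvature -/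

/-- The derivative of `level` at `p` in the direction `Z`. -/
def levelDeriv (p Z : ℂ × ℂ) : ℂ :=
  3 * (p.1.im : ℂ) ^ 2 * Z.1.im * (p.2 * conj p.2) +
    (p.1.im : ℂ) ^ 3 * (Z.2 * conj p.2 + p.2 * conj Z.2)

/-- The derivative of the coefficients of `mixed` at `p` in the direction `Z`. -/
def mixedDeriv (p Z X Y : ℂ × ℂ) : ℂ :=
  -3 * I * (Z.2 / (p.1.im : ℂ) - p.2 * Z.1.im / (p.1.im : ℂ) ^ 2) * (X.1 * Y.1)

/-- The derivative of the Christoffel symbols at `p` in the direction `Z`. -/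
def christoffelDeriv (k : ℝ) (p Z X Y : ℂ × ℂ) : ℂ × ℂ :=
  (((3 * (p.1.im : ℂ) ^ 2 * Z.1.im * conj p.2 + (p.1.im : ℂ) ^ 3 * conj Z.2) / (1 + k * level p) -
          (p.1.im : ℂ) ^ 3 * conj p.2 * (k * levelDeriv p Z) / (1 + k * level p) ^ 2) *
        (k * mixed p X Y) +
      k * (p.1.im : ℂ) ^ 3 * conj p.2 / (1 + k * level p) * mixedDeriv p Z X Y -
      I * Z.1.im / (p.1.im : ℂ) ^ 2 * (X.1 * Y.1),
    3 * I / 2 * (Z.1.im / ((p.1.im : ℂ) ^ 2 * (1 + k * level p)) +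
          k * levelDeriv p Z / ((p.1.im : ℂ) * (1 + k * level p) ^ 2)) * mixed p X Y -
      3 * I / (2 * (p.1.im : ℂ)) / (1 + k * level p) * mixedDeriv p Z X Y +
      3 / 2 * (Z.2 / (p.1.im : ℂ) ^ 2 - 2 * p.2 * Z.1.im / (p.1.im : ℂ) ^ 3) * (X.1 * Y.1))

section Linearity

variable (k : ℝ) (p : ℂ × ℂ)

lemma christoffel_symm (X Y : ℂ × ℂ) : christoffel k p X Y = christoffel k p Y X := by
  simp only [christoffel, mixed]
  ext <;> ring

lemma christoffel_add_left (X X' Y : ℂ × ℂ) :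
    christoffel k p (X + X') Y = christoffel k p X Y + christoffel k p X' Y := by
  simp only [christoffel, mixed, Prod.fst_add, Prod.snd_add, Prod.mk_add_mk]
  ext <;> ring

lemma christoffel_add_right (X Y Y' : ℂ × ℂ) :
    christoffel k p X (Y + Y') = christoffel k p X Y + christoffel k p X Y' := by
  simp only [christoffel_symm k p X, christoffel_add_left]

lemma christoffel_sub_right (X Y Y' : ℂ × ℂ) :
    christoffel k p X (Y - Y') = christoffel k p X Y - christoffel k p X Y' := by
  rw [eq_sub_iff_add_eq, ← christoffel_add_right, sub_add_cancel]

end Linearity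

section Curves

variable {P X Y : ℝ → ℂ × ℂ} {P' X' Y' : ℂ × ℂ} {s : ℝ}

lemma hasDerivAt_mixed (hP : HasDerivAt P P' s) (hX : HasDerivAt X X' s)
    (hY : HasDerivAt Y Y' s) (hp : 0 < (P s).1.im) :
    HasDerivAt (fun s => mixed (P s) (X s) (Y s))
      (mixedDeriv (P s) P' (X s) (Y s) + mixed (P s) X' (Y s) + mixed (P s) (X s) Y') s := by
  have hy := hP.fst_comp.ofReal_im_comp
  have h0 : ((P s).1.im : ℂ) ≠ 0 := by exact_mod_cast hp.ne'
  refine (((hX.fst_comp.mul hY.snd_comp).add (hX.snd_comp.mul hY.fst_comp)).sub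
    ((((hasDerivAt_const s (3 * I)).div hy h0).mul hP.snd_comp).mul
      (hX.fst_comp.mul hY.fst_comp))).congr_deriv ?_
  simp only [mixed, mixedDeriv, Pi.div_apply, Pi.mul_apply]
  field_simp
  ring

lemma hasDerivAt_christoffel {k : ℝ} (hk : 0 < k) (hP : HasDerivAt P P' s)
    (hX : HasDerivAt X X' s) (hY : HasDerivAt Y Y' s) (hp : 0 < (P s).1.im) :
    HasDerivAt (fun s => christoffel k (P s) (X s) (Y s))
      (christoffelDeriv k (P s) P' (X s) (Y s) + christoffel k (P s) X' (Y s) +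
        christoffel k (P s) (X s) Y') s := by
  have hy := hP.fst_comp.ofReal_im_comp
  have hw := hP.snd_comp
  have h0 : ((P s).1.im : ℂ) ≠ 0 := by exact_mod_cast hp.ne'
  have hn := one_add_mul_level_ne_zero hk hp
  have ht : HasDerivAt (fun s => 1 + k * level (P s)) (k * levelDeriv (P s) P') s :=
    ((hasDerivAt_level hP).const_mul (k : ℂ)).const_add 1
  have hm := hasDerivAt_mixed hP hX hY hp
  have hxy := hX.fst_comp.mul hY.fst_comp
  refine ((((((hy.pow 3).const_mul (k : ℂ)).mul hw.conj_comp).div ht hn).mul hm |>.add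
    (((hasDerivAt_const s I).div hy h0).mul hxy)).prodMk
    (((((hasDerivAt_const s (3 * I)).div (hy.const_mul 2) (by simpa using h0)).neg.div ht hn).mul hm
      |>.add ((((hasDerivAt_const s (3 : ℂ)).div ((hy.pow 2).const_mul 2)
      (by simpa using h0)).mul hw).mul hxy)))).congr_deriv ?_
  clear ht hm hxy hy hw hP hX hY
  simp only [Pi.mul_apply, Pi.div_apply, Pi.pow_apply, Pi.neg_apply, christoffel, christoffelDeriv,
    Prod.mk_add_mk, mixed, mixedDeriv]
  generalize levelDeriv (P s) P' = t' at *
  obtain ⟨n, hnt⟩ : ∃ n, n = 1 + k * level (P s) := ⟨_, rfl⟩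
  rw [← hnt] at hn ⊢
  ext <;> simp only <;> field_simp <;> ring

end Curves

/-- The curvature tensor `R(X, Y) V` in terms of the Christoffel symbols. -/
def curvature (k : ℝ) (p X Y V : ℂ × ℂ) : ℂ × ℂ :=
  christoffelDeriv k p X Y V + christoffel k p X (christoffel k p Y V) -
    (christoffelDeriv k p Y X V + christoffel k p Y (christoffel k p X V))

/-- The antiholomorphic derivative of the Christoffel symbols in the direction `X`. -/
def christoffelDbar (k : ℝ) (p X Y V : ℂ × ℂ) : ℂ × ℂ :=
  (k * (p.1.im : ℂ) ^ 3 / (1 + k * level p) ^ 2 * conj (vert p X) * mixed p Y V +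
      (1 - 2 * k * level p) / (2 * (1 + k * level p) * (p.1.im : ℂ) ^ 2) * conj X.1 * (Y.1 * V.1),
    -(3 / 4) / ((p.1.im : ℂ) ^ 2 * (1 + k * level p)) * conj X.1 * mixed p Y V +
      3 * I / 2 * k * (p.1.im : ℂ) ^ 2 * p.2 / (1 + k * level p) ^ 2 * conj (vert p X) *
        mixed p Y V +
      (9 * I / (4 * (p.1.im : ℂ) ^ 3 * (1 + k * level p)) - 3 * I / (2 * (p.1.im : ℂ) ^ 3)) *
        p.2 * conj X.1 * (Y.1 * V.1))

/-- For a Chern connection the (2,0) part of the curvature vanishes: the holomorphic derivatives of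
the symbols cancel against their quadratic terms, and only the antiholomorphic derivatives survive.
-/
lemma curvature_eq {k : ℝ} (hk : 0 < k) {p : ℂ × ℂ} (hp : 0 < p.1.im) (X Y V : ℂ × ℂ) :
    curvature k p X Y V = christoffelDbar k p X Y V - christoffelDbar k p Y X V := by
  have h0 : (p.1.im : ℂ) ≠ 0 := by exact_mod_cast hp.ne'
  have hn := one_add_mul_level_ne_zero hk hp
  have hI : I ^ 2 = -1 := I_sq
  have hn' : level p = (p.1.im : ℂ) ^ 3 * (p.2 * conj p.2) := rfl
  simp only [curvature, christoffelDeriv, christoffelDbar, christoffel, mixed, mixedDeriv, vert,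
    levelDeriv, Prod.mk_add_mk, Prod.mk_sub_mk, map_sub, map_mul, map_div₀, conj_I, conj_ofReal,
    map_ofNat, im_eq_sub_conj X.1, im_eq_sub_conj Y.1]
  generalize level p = t at *
  generalize (p.1.im : ℂ) = y at *
  generalize p.2 = w at *
  generalize conj w = wb at *
  generalize X.1 = X1 at *
  generalize Y.1 = Y1 at *
  generalize X.2 = X2 at *
  generalize Y.2 = Y2 at *
  generalize V.1 = V1 at *
  generalize V.2 = V2 at *
  generalize conj X1 = X1b at *
  generalize conj Y1 = Y1b at *
  generalize conj X2 = X2b at *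
  generalize conj Y2 = Y2b at *
  generalize (k : ℂ) = κ at *
  clear hk hp p
  obtain ⟨n, hnt⟩ : ∃ n, n = 1 + κ * t := ⟨_, rfl⟩
  rw [← hnt] at hn ⊢
  ext <;> simp only <;> field_simp <;> subst hnt hn' <;> rw [← sub_eq_zero] <;> grind

/-! ### Metric maps are affine and preserve curvature -/

/-- The image of `ℍ × ℂ` in `ℂ × ℂ`. -/
def domain : Set (ℂ × ℂ) := {p | 0 < p.1.im}

lemma isOpen_domain : IsOpen domain :=
  isOpen_lt continuous_const (continuous_im.comp continuous_fst)

/-- Smooth self-maps of the domain `ℍ × ℂ ⊆ ℂ × ℂ` that preserve the real part of `herm`. -/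
structure IsMetricMap (k : ℝ) (φ : ℂ × ℂ → ℂ × ℂ) : Prop where
  contDiffOn : ContDiffOn ℝ ∞ φ domain
  mapsTo : Set.MapsTo φ domain domain
  herm_re : ∀ p ∈ domain, ∀ X Y,
    (herm k (φ p) (fderiv ℝ φ p X) (fderiv ℝ φ p Y)).re = (herm k p X Y).re

section Algebra

variable (k : ℝ) (p : ℂ × ℂ)

lemma vert_add (X X' : ℂ × ℂ) : vert p (X + X') = vert p X + vert p X' := by
  simp only [vert, Prod.fst_add, Prod.snd_add]; ring

lemma vert_sub (X X' : ℂ × ℂ) : vert p (X - X') = vert p X - vert p X' := by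
  simp only [vert, Prod.fst_sub, Prod.snd_sub]; ring

lemma herm_sub_left (X X' Y : ℂ × ℂ) : herm k p (X - X') Y = herm k p X Y - herm k p X' Y := by
  simp only [herm, vert_sub, Prod.fst_sub]; ring

lemma herm_sub_right (X Y Y' : ℂ × ℂ) : herm k p X (Y - Y') = herm k p X Y - herm k p X Y' := by
  simp only [herm, vert_sub, Prod.fst_sub, map_sub]; ring

lemma conj_level : conj (level p) = level p := by rw [level_eq_ofReal, conj_ofReal]

lemma conj_herm (X Y : ℂ × ℂ) : conj (herm k p X Y) = herm k p Y X := by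
  simp only [herm, map_sub, map_mul, map_div₀, map_add, map_one, conj_ofReal, conj_level, map_pow,
    conj_conj, map_ofNat]
  ring

lemma herm_re_symm (X Y : ℂ × ℂ) : (herm k p X Y).re = (herm k p Y X).re := by
  rw [← conj_herm, conj_re]

variable {k p}

/-- Nondegeneracy of the metric: testing against vertical vectors kills the vertical part of X, and
testing against vectors (u, 0) then kills its base component. -/
lemma eq_zero_of_herm_re_eq_zero (hk : 0 < k) (hp : p ∈ domain) {X : ℂ × ℂ}
    (h : ∀ Y, (herm k p X Y).re = 0) : X = 0 := by
  have h0 : (p.1.im : ℂ) ≠ 0 := by exact_mod_cast (show 0 < p.1.im from hp).ne'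
  have hkc : (k : ℂ) ≠ 0 := by exact_mod_cast hk.ne'
  have hn := one_add_mul_level_ne_zero hk hp
  have key : ∀ c : ℂ, (∀ u : ℂ, (c * conj u).re = 0) → c = 0 := fun c hc => by
    have := hc c
    rw [mul_conj, ofReal_re] at this
    exact normSq_eq_zero.mp this
  have hv : vert p X = 0 := by
    have := key (4 / 3 * k * (p.1.im : ℂ) ^ 3 * vert p X) fun u => by
      have := h (0, u)
      simp only [herm, vert, map_zero, mul_zero, zero_sub, neg_re, sub_zero, neg_eq_zero] at this ⊢
      rw [← this]; congr 1; ring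
    simpa [h0, hkc] using this
  have h1 : X.1 = 0 := by
    have := key ((1 + k * level p) / (p.1.im : ℂ) ^ 2 * X.1) fun u => by
      have := h (u, 0)
      simp only [herm, hv, zero_mul, mul_zero, sub_zero] at this
      rw [← this]; congr 1; ring
    simpa [h0, hn] using this
  refine Prod.ext h1 ?_
  simpa [vert, h1] using hv

end Algebra

lemma two_le_smoothness : minSmoothness ℝ 2 ≤ (∞ : WithTop ℕ∞) := by
  rw [minSmoothness_of_isRCLikeNormedField]
  exact WithTop.coe_le_coe.2 (le_top : (2 : ℕ∞) ≤ ⊤)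

namespace IsMetricMap

variable {k : ℝ} {φ : ℂ × ℂ → ℂ × ℂ} {p : ℂ × ℂ}

lemma contDiffAt (h : IsMetricMap k φ) (hp : p ∈ domain) : ContDiffAt ℝ ∞ φ p :=
  h.contDiffOn.contDiffAt (isOpen_domain.mem_nhds hp)

lemma hasFDerivAt (h : IsMetricMap k φ) (hp : p ∈ domain) :
    HasFDerivAt φ (fderiv ℝ φ p) p :=
  ((h.contDiffAt hp).differentiableAt (by simp)).hasFDerivAt

lemma contDiffAt_fderiv (h : IsMetricMap k φ) (hp : p ∈ domain) :
    ContDiffAt ℝ ∞ (fderiv ℝ φ) p :=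
  (h.contDiffAt hp).fderiv_right (by simp)

lemma hasFDerivAt_fderiv (h : IsMetricMap k φ) (hp : p ∈ domain) :
    HasFDerivAt (fderiv ℝ φ) (fderiv ℝ (fderiv ℝ φ) p) p :=
  ((h.contDiffAt_fderiv hp).differentiableAt (by simp)).hasFDerivAt

lemma injective_fderiv (hk : 0 < k) (h : IsMetricMap k φ) (hp : p ∈ domain) :
    Function.Injective (fderiv ℝ φ p) := by
  refine (injective_iff_map_eq_zero _).mpr fun X hX => eq_zero_of_herm_re_eq_zero hk hp fun Y => ?_
  rw [← h.herm_re p hp, hX]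
  simp [herm, vert]

lemma surjective_fderiv (hk : 0 < k) (h : IsMetricMap k φ) (hp : p ∈ domain) :
    Function.Surjective (fderiv ℝ φ p) :=
  LinearMap.surjective_of_injective (f := (fderiv ℝ φ p : ℂ × ℂ →ₗ[ℝ] ℂ × ℂ))
    (h.injective_fderiv hk hp)

lemma _root_.TorusCubic.hasDerivAt_line (p Z : ℂ × ℂ) :
    HasDerivAt (fun s : ℝ => p + s • Z) Z 0 := by
  simpa using ((hasDerivAt_id (0 : ℝ)).smul_const Z).const_add p

lemma _root_.HasFDerivAt.hasDerivAt_line {F : Type*} [NormedAddCommGroup F] [NormedSpace ℝ F]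
    {f : ℂ × ℂ → F} {f' : ℂ × ℂ →L[ℝ] F} {p : ℂ × ℂ} (h : HasFDerivAt f f' p) (Z : ℂ × ℂ) :
    HasDerivAt (fun s : ℝ => f (p + s • Z)) (f' Z) 0 :=
  HasFDerivAt.comp_hasDerivAt (0 : ℝ) (by simpa using h) (TorusCubic.hasDerivAt_line p Z)

lemma _root_.TorusCubic.eventually_line_mem (hp : p ∈ domain) (Z : ℂ × ℂ) :
    ∀ᶠ s : ℝ in nhds 0, p + s • Z ∈ domain :=
  (TorusCubic.hasDerivAt_line p Z).continuousAt.eventually_mem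
    (isOpen_domain.mem_nhds (by simpa using hp))

/-- A metric map is affine for the Levi-Civita connection. -/
lemma fderiv_fderiv_apply (hk : 0 < k) (h : IsMetricMap k φ) (hp : p ∈ domain) (Z X : ℂ × ℂ) :
    fderiv ℝ (fderiv ℝ φ) p Z X = fderiv ℝ φ p (christoffel k p Z X) -
      christoffel k (φ p) (fderiv ℝ φ p Z) (fderiv ℝ φ p X) := by
  -- T measures the failure of φ to be affine. It is symmetric because second derivatives commute
  -- and the connection is torsion-free.
  set T : ℂ × ℂ → ℂ × ℂ → ℂ × ℂ := fun Z X => fderiv ℝ (fderiv ℝ φ) p Z X +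
    christoffel k (φ p) (fderiv ℝ φ p Z) (fderiv ℝ φ p X) - fderiv ℝ φ p (christoffel k p Z X)
    with hT
  have symm : ∀ Z X, T Z X = T X Z := fun Z X => by
    have := (h.contDiffAt hp).isSymmSndFDerivAt two_le_smoothness Z X
    simp only [hT, this, christoffel_symm k p Z X, christoffel_symm k (φ p) (fderiv ℝ φ p Z)]
  -- Differentiating the invariance of the metric along Z, with X and Y constant, turns
  -- compatibility of the connection into skewness of T.
  have anti : ∀ Z X Y, (herm k (φ p) (T Z X) (fderiv ℝ φ p Y)).re +
      (herm k (φ p) (fderiv ℝ φ p X) (T Z Y)).re = 0 := fun Z X Y => by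
    have d0 := (h.hasFDerivAt hp).hasDerivAt_line Z
    have d1 := fun V : ℂ × ℂ =>
      ((h.hasFDerivAt_fderiv hp).hasDerivAt_line Z).clm_apply (hasDerivAt_const (0 : ℝ) V)
    have e1 := hasDerivAt_herm hk d0 (d1 X) (d1 Y) (by simpa using! h.mapsTo hp)
    have e2 := hasDerivAt_herm hk (hasDerivAt_line p Z) (hasDerivAt_const (0 : ℝ) X)
      (hasDerivAt_const (0 : ℝ) Y) (by simpa using! hp)
    have e1' := reCLM.hasFDerivAt.comp_hasDerivAt (0 : ℝ) e1
    have e2' := reCLM.hasFDerivAt.comp_hasDerivAt (0 : ℝ) e2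
    have e3 := e1'.unique (e2'.congr_of_eventuallyEq ?_)
    · simp only [zero_smul, add_zero, map_zero, zero_add, reCLM_apply, add_re, ← h.herm_re p hp]
        at e3
      simp only [hT, herm_sub_left, herm_sub_right, sub_re]
      linarith
    · filter_upwards [eventually_line_mem hp Z] with s hs
      simpa using h.herm_re _ hs X Y
  -- A trilinear form symmetric in the first two arguments and skew in the last two vanishes, as in
  -- the uniqueness of the Levi-Civita connection.
  have zero : ∀ Z X Y, (herm k (φ p) (T Z X) (fderiv ℝ φ p Y)).re = 0 := fun Z X Y => by
    have a1 := anti Z X Y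
    have a2 := anti X Y Z
    have a3 := anti Y Z X
    rw [herm_re_symm k _ (fderiv ℝ φ p _) (T _ _)] at a1 a2 a3
    rw [symm X Y, symm X Z] at a2
    rw [symm Y Z] at a3
    linarith
  have hzero : T Z X = 0 := eq_zero_of_herm_re_eq_zero hk (h.mapsTo hp) fun W => by
    obtain ⟨Y, rfl⟩ := h.surjective_fderiv hk hp W
    exact zero Z X Y
  rw [hT] at hzero
  rw [eq_sub_iff_add_eq]
  exact sub_eq_zero.mp hzero

/-- Naturality of the curvature tensor. -/
lemma curvature_comp (hk : 0 < k) (h : IsMetricMap k φ) (hp : p ∈ domain) (X Y V : ℂ × ℂ) :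
    curvature k (φ p) (fderiv ℝ φ p X) (fderiv ℝ φ p Y) (fderiv ℝ φ p V) =
      fderiv ℝ φ p (curvature k p X Y V) := by
  -- The affine equation is differentiated once more along Y, and each second derivative that
  -- appears is eliminated by the same equation.
  have third : ∀ X Y, fderiv ℝ (fderiv ℝ (fderiv ℝ φ)) p Y X V =
      fderiv ℝ φ p (christoffelDeriv k p Y X V + christoffel k p Y (christoffel k p X V)) -
      (christoffelDeriv k (φ p) (fderiv ℝ φ p Y) (fderiv ℝ φ p X) (fderiv ℝ φ p V) +
        christoffel k (φ p) (fderiv ℝ φ p Y) (fderiv ℝ φ p (christoffel k p X V)) +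
        christoffel k (φ p) (fderiv ℝ φ p X) (fderiv ℝ φ p (christoffel k p Y V)) +
        christoffel k (φ p) (fderiv ℝ φ p V) (fderiv ℝ φ p (christoffel k p Y X)) -
        christoffel k (φ p) (fderiv ℝ φ p X)
          (christoffel k (φ p) (fderiv ℝ φ p Y) (fderiv ℝ φ p V)) -
        christoffel k (φ p) (fderiv ℝ φ p V)
          (christoffel k (φ p) (fderiv ℝ φ p Y) (fderiv ℝ φ p X))) := fun X Y => by
    have d0 := (h.hasFDerivAt hp).hasDerivAt_line Y
    have d1 := (h.hasFDerivAt_fderiv hp).hasDerivAt_line Y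
    have c2 : ContDiffAt ℝ ∞ (fderiv ℝ (fderiv ℝ φ)) p :=
      (h.contDiffAt_fderiv hp).fderiv_right (by simp)
    have d2 := ((((c2.differentiableAt (by simp)).hasFDerivAt).hasDerivAt_line Y).clm_apply
      (hasDerivAt_const (0 : ℝ) X)).clm_apply (hasDerivAt_const (0 : ℝ) V)
    have e1 := d1.clm_apply (hasDerivAt_christoffel hk (hasDerivAt_line p Y)
      (hasDerivAt_const (0 : ℝ) X) (hasDerivAt_const (0 : ℝ) V) (by simpa using! hp))
    have e2 := hasDerivAt_christoffel hk d0 (d1.clm_apply (hasDerivAt_const (0 : ℝ) X))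
      (d1.clm_apply (hasDerivAt_const (0 : ℝ) V)) (by simpa using! h.mapsTo hp)
    have e3 := d2.unique ((e1.sub e2).congr_of_eventuallyEq ?_)
    · have z1 : ∀ q W, christoffel k q 0 W = 0 := fun q W => by simp [christoffel, mixed]
      have z2 : ∀ q W, christoffel k q W 0 = 0 := fun q W => by simp [christoffel, mixed]
      simp only [zero_smul, add_zero, map_zero, h.fderiv_fderiv_apply hk hp, sub_zero,
        christoffel_sub_right, z1, z2,
        christoffel_symm k (φ p) (_ - _) (fderiv ℝ φ p V)] at e3
      rw [e3]
      simp only [map_add]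
      abel
    · filter_upwards [eventually_line_mem hp Y] with s hs
      simp only [h.fderiv_fderiv_apply hk hs, Pi.sub_apply]
  -- Exchanging X and Y leaves the third derivative unchanged. The terms of `third` that are
  -- symmetric in X and Y cancel, and the rest is the curvature identity.
  have symm : fderiv ℝ (fderiv ℝ (fderiv ℝ φ)) p X Y V = fderiv ℝ (fderiv ℝ (fderiv ℝ φ)) p Y X V :=
    DFunLike.congr_fun ((h.contDiffAt_fderiv hp).isSymmSndFDerivAt two_le_smoothness X Y) V
  rw [third, third, christoffel_symm k p X Y,
    christoffel_symm k (φ p) (fderiv ℝ φ p X) (fderiv ℝ φ p Y)] at symm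
  simp only [curvature, map_sub, sub_eq_iff_eq_add] at symm ⊢
  rw [symm]
  abel

end IsMetricMap

/-! ### Ricci and scalar curvature -/

/-- The real trace of an endomorphism of `ℂ × ℂ`. -/
lemma trace_complex_prod (f : ℂ × ℂ →ₗ[ℝ] ℂ × ℂ) :
    LinearMap.trace ℝ _ f =
      (f (1, 0)).1.re + (f (I, 0)).1.im + ((f (0, 1)).2.re + (f (0, I)).2.im) := by
  rw [LinearMap.trace_eq_matrix_trace ℝ (Complex.basisOneI.prod Complex.basisOneI)]
  simp [Matrix.trace, LinearMap.toMatrix_apply, Fin.sum_univ_two]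

/-- The real number underlying `level`. -/
def realLevel (p : ℂ × ℂ) : ℝ := p.1.im ^ 3 * normSq p.2

lemma level_eq (p : ℂ × ℂ) : level p = (realLevel p : ℂ) := level_eq_ofReal p

lemma realLevel_nonneg {p : ℂ × ℂ} (hp : p ∈ domain) : 0 ≤ realLevel p :=
  mul_nonneg (pow_nonneg (le_of_lt hp) 3) (normSq_nonneg _)

/-- The curvature as an endomorphism `X ↦ R(X, Y) V`. -/
def curvatureEndo (k : ℝ) (p Y V : ℂ × ℂ) : ℂ × ℂ →ₗ[ℝ] ℂ × ℂ where
  toFun X := christoffelDbar k p X Y V - christoffelDbar k p Y X V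
  map_add' X X' := by
    simp only [christoffelDbar, mixed, vert_add, map_add, Prod.fst_add, Prod.snd_add]
    ext <;> simp only [Prod.fst_add, Prod.fst_sub, Prod.snd_add, Prod.snd_sub] <;> ring
  map_smul' c X := by
    simp only [christoffelDbar, mixed, vert, map_sub, map_mul, Prod.smul_fst, Prod.smul_snd,
      real_smul, conj_ofReal, RingHom.id_apply]
    ext <;> simp only [Prod.smul_fst, Prod.smul_snd, Prod.fst_sub, Prod.snd_sub, real_smul] <;> ring

/-- The Ricci endomorphism of the metric. -/
def ricciEndo (k : ℝ) (p : ℂ × ℂ) : ℂ × ℂ →ₗ[ℝ] ℂ × ℂ where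
  toFun X :=
    -- The eigenvalues: a on horizontal vectors and b on vertical ones. The second component below
    -- says that the vertical part of the image is b times that of X.
    let a : ℝ := (1 + 4 * k * realLevel p) / (2 * (1 + k * realLevel p) ^ 2)
    let b : ℝ := 3 / (2 * (1 + k * realLevel p) ^ 2)
    (a * X.1, b * X.2 + (a - b) * (3 * I / (2 * p.1.im) * p.2 * X.1))
  map_add' X X' := by
    simp only [Prod.fst_add, Prod.snd_add]
    ext <;> simp only [Prod.fst_add, Prod.snd_add] <;> ring
  map_smul' c X := by
    simp only [Prod.smul_fst, Prod.smul_snd, real_smul, RingHom.id_apply]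
    ext <;> simp only [Prod.smul_fst, Prod.smul_snd, real_smul] <;> ring

/-- The scalar curvature. -/
lemma trace_ricciEndo {k : ℝ} (hk : 0 < k) {p : ℂ × ℂ} (hp : p ∈ domain) :
    LinearMap.trace ℝ _ (ricciEndo k p) = 4 / (1 + k * realLevel p) := by
  have := realLevel_nonneg hp
  have h : 1 + k * realLevel p ≠ 0 := by positivity
  rw [trace_complex_prod]
  simp only [ricciEndo, LinearMap.coe_mk, AddHom.coe_mk, mul_zero, mul_one, add_zero, ofReal_re,
    im_ofReal_mul, I_im]
  field_simp
  ring

/-- The Ricci tensor is represented by the Ricci endomorphism. -/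
lemma trace_curvatureEndo {k : ℝ} (hk : 0 < k) {p : ℂ × ℂ} (hp : p ∈ domain) (Y V : ℂ × ℂ) :
    LinearMap.trace ℝ _ (curvatureEndo k p Y V) = (herm k p V (ricciEndo k p Y)).re := by
  have h0 : (p.1.im : ℂ) ≠ 0 := by exact_mod_cast (show 0 < p.1.im from hp).ne'
  have hn := one_add_mul_level_ne_zero hk hp
  have hI : I ^ 2 = -1 := I_sq
  -- `christoffelDbar` is antilinear in its first direction, so that summand has real trace zero. It
  -- is linear in the second, which contributes twice the real part of a complex trace.
  have anti₁ : (christoffelDbar k p (I, 0) Y V).1 = -I * (christoffelDbar k p (1, 0) Y V).1 := by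
    simp only [christoffelDbar, vert, map_sub, map_mul, conj_I, map_zero, map_one]
    ring
  have anti₂ : (christoffelDbar k p (0, I) Y V).2 = -I * (christoffelDbar k p (0, 1) Y V).2 := by
    simp only [christoffelDbar, vert, map_sub, map_mul, conj_I, map_zero, map_one]
    ring
  have lin₁ : (christoffelDbar k p Y (I, 0) V).1 = I * (christoffelDbar k p Y (1, 0) V).1 := by
    simp only [christoffelDbar, mixed]
    ring
  have lin₂ : (christoffelDbar k p Y (0, I) V).2 = I * (christoffelDbar k p Y (0, 1) V).2 := by
    simp only [christoffelDbar, mixed]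
    ring
  have key : -2 * ((christoffelDbar k p Y (1, 0) V).1 + (christoffelDbar k p Y (0, 1) V).2) =
      herm k p V (ricciEndo k p Y) := by
    simp only [christoffelDbar, mixed, herm, ricciEndo, LinearMap.coe_mk, AddHom.coe_mk, vert,
      map_add, map_sub, map_mul, map_div₀, conj_I, conj_ofReal, map_ofNat, ofReal_div, ofReal_add,
      ofReal_mul, ofReal_one, ofReal_ofNat, ofReal_pow, ← level_eq, conj_level, map_pow, map_one]
    have hn' : level p = (p.1.im : ℂ) ^ 3 * (p.2 * conj p.2) := rfl
    generalize level p = t at *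
    generalize (p.1.im : ℂ) = y at *
    generalize p.2 = w at *
    generalize conj w = wb at *
    generalize Y.1 = Y1 at *
    generalize Y.2 = Y2 at *
    generalize V.1 = V1 at *
    generalize V.2 = V2 at *
    generalize conj Y1 = Y1b at *
    generalize conj Y2 = Y2b at *
    generalize (k : ℂ) = κ at *
    clear anti₁ anti₂ lin₁ lin₂
    obtain ⟨n, hnt⟩ : ∃ n, n = 1 + κ * t := ⟨_, rfl⟩
    rw [← hnt] at hn ⊢
    field_simp
    subst hnt hn'
    rw [← sub_eq_zero]
    grind
  rw [trace_complex_prod, ← key]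
  simp only [curvatureEndo, LinearMap.coe_mk, AddHom.coe_mk, Prod.fst_sub, Prod.snd_sub, anti₁,
    anti₂, lin₁, lin₂, sub_re, sub_im, mul_im, mul_re, neg_re, neg_im, I_re, I_im, add_re, add_im,
    re_ofNat, im_ofNat]
  ring

namespace IsMetricMap

variable {k : ℝ} {φ : ℂ × ℂ → ℂ × ℂ} {p : ℂ × ℂ}

/-- The differential of a metric map as a linear equivalence. -/
def fderivEquiv (hk : 0 < k) (h : IsMetricMap k φ) (hp : p ∈ domain) : (ℂ × ℂ) ≃ₗ[ℝ] (ℂ × ℂ) :=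
  LinearEquiv.ofBijective (fderiv ℝ φ p : ℂ × ℂ →ₗ[ℝ] ℂ × ℂ)
    ⟨h.injective_fderiv hk hp, h.surjective_fderiv hk hp⟩

lemma trace_curvatureEndo_comp (hk : 0 < k) (h : IsMetricMap k φ) (hp : p ∈ domain)
    (Y V : ℂ × ℂ) :
    LinearMap.trace ℝ _ (curvatureEndo k (φ p) (fderiv ℝ φ p Y) (fderiv ℝ φ p V)) =
      LinearMap.trace ℝ _ (curvatureEndo k p Y V) := by
  rw [← LinearMap.trace_conj' (curvatureEndo k p Y V) (h.fderivEquiv hk hp)]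
  congr 1
  refine LinearMap.ext fun W => ?_
  obtain ⟨X, rfl⟩ := (h.fderivEquiv hk hp).surjective W
  have := h.curvature_comp hk hp X Y V
  rw [curvature_eq hk hp, curvature_eq hk (h.mapsTo hp)] at this
  rw [LinearEquiv.conj_apply_apply, LinearEquiv.symm_apply_apply]
  exact this

lemma ricciEndo_fderiv (hk : 0 < k) (h : IsMetricMap k φ) (hp : p ∈ domain) (Y : ℂ × ℂ) :
    ricciEndo k (φ p) (fderiv ℝ φ p Y) = fderiv ℝ φ p (ricciEndo k p Y) := by
  rw [← sub_eq_zero]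
  refine eq_zero_of_herm_re_eq_zero hk (h.mapsTo hp) fun W => ?_
  obtain ⟨V, rfl⟩ := h.surjective_fderiv hk hp W
  rw [herm_re_symm, herm_sub_right, sub_re, h.herm_re p hp, ← trace_curvatureEndo hk hp,
    ← trace_curvatureEndo hk (h.mapsTo hp), h.trace_curvatureEndo_comp hk hp, sub_self]

/-- A metric map preserves the function `y ^ 3 |w| ^ 2`. -/
lemma realLevel_comp (hk : 0 < k) (h : IsMetricMap k φ) (hp : p ∈ domain) :
    realLevel (φ p) = realLevel p := by
  have h1 : LinearMap.trace ℝ _ (ricciEndo k (φ p)) = LinearMap.trace ℝ _ (ricciEndo k p) := by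
    -- The Ricci endomorphisms at p and φ p are conjugate under the differential, so the scalar
    -- curvatures agree.
    rw [← LinearMap.trace_conj' (ricciEndo k p) (h.fderivEquiv hk hp)]
    congr 1
    refine LinearMap.ext fun W => ?_
    obtain ⟨X, rfl⟩ := (h.fderivEquiv hk hp).surjective W
    rw [LinearEquiv.conj_apply_apply, LinearEquiv.symm_apply_apply]
    exact h.ricciEndo_fderiv hk hp X
  rw [trace_ricciEndo hk hp, trace_ricciEndo hk (h.mapsTo hp)] at h1
  have := realLevel_nonneg hp
  have := realLevel_nonneg (h.mapsTo hp)
  have h2 : 1 + k * realLevel p ≠ 0 := by positivity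
  have h3 : 1 + k * realLevel (φ p) ≠ 0 := by positivity
  field_simp at h1
  have : k * (realLevel (φ p) - realLevel p) = 0 := by linarith
  rcases mul_eq_zero.mp this with h | h <;> linarith

end IsMetricMap

/-! ### The Euler field and the linearity on fibres -/

/-- The connection is unitary for the fibre norm y³|w|², so horizontal motion does not change the
level. -/
lemma levelDeriv_eq {p : ℂ × ℂ} (hp : p ∈ domain) (X : ℂ × ℂ) :
    levelDeriv p X = (p.1.im : ℂ) ^ 3 * (p.2 * conj (vert p X) + conj p.2 * vert p X) := by
  have h0 : (p.1.im : ℂ) ≠ 0 := by exact_mod_cast (show 0 < p.1.im from hp).ne'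
  have hI : I ^ 2 = -1 := I_sq
  simp only [levelDeriv, vert, map_sub, map_mul, map_div₀, conj_I, conj_ofReal, map_ofNat,
    im_eq_sub_conj X.1]
  field_simp
  rw [← sub_eq_zero]
  grind

/-- The Euler field is a multiple of the gradient of `level`. -/
lemma herm_euler_re (k : ℝ) {p : ℂ × ℂ} (hp : p ∈ domain) (X : ℂ × ℂ) :
    (herm k p (0, p.2) X).re = -(2 / 3 * k) * (levelDeriv p X).re := by
  rw [levelDeriv_eq hp]
  have : herm k p (0, p.2) X =
      ((-(4 / 3 * k * p.1.im ^ 3) : ℝ) : ℂ) * (p.2 * conj (vert p X)) := by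
    simp only [herm, vert, ofReal_neg, ofReal_mul, ofReal_div, ofReal_pow, ofReal_ofNat]
    ring
  rw [this, re_ofReal_mul, ← ofReal_pow, re_ofReal_mul, add_re]
  have h2 : (conj p.2 * vert p X).re = (p.2 * conj (vert p X)).re := by
    rw [← conj_re, map_mul, conj_conj]
  rw [h2]
  ring

lemma _root_.HasDerivAt.id_smul {E : Type*} [NormedAddCommGroup E] [NormedSpace ℝ E] {f : ℝ → E}
    {f' : E} {r : ℝ} (hf : HasDerivAt f f' r) :
    HasDerivAt (fun r => r • f r) (r • f' + f r) r := by
  simpa using (hasDerivAt_id' r).fun_smul hf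

namespace IsMetricMap

variable {k : ℝ} {φ : ℂ × ℂ → ℂ × ℂ} {p : ℂ × ℂ}

lemma levelDeriv_comp (hk : 0 < k) (h : IsMetricMap k φ) (hp : p ∈ domain) (X : ℂ × ℂ) :
    levelDeriv (φ p) (fderiv ℝ φ p X) = levelDeriv p X := by
  have e1 := hasDerivAt_level ((h.hasFDerivAt hp).hasDerivAt_line X)
  have e2 := hasDerivAt_level (hasDerivAt_line p X)
  have e3 := e1.unique (e2.congr_of_eventuallyEq ?_)
  · simpa only [zero_smul, add_zero] using! e3
  · filter_upwards [eventually_line_mem hp X] with s hs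
    rw [level_eq, level_eq, h.realLevel_comp hk hs]

/-- A metric map preserves the Euler field of the fibres. -/
lemma fderiv_euler (hk : 0 < k) (h : IsMetricMap k φ) (hp : p ∈ domain) :
    fderiv ℝ φ p (0, p.2) = (0, (φ p).2) := by
  rw [← sub_eq_zero]
  refine eq_zero_of_herm_re_eq_zero hk (h.mapsTo hp) fun W => ?_
  obtain ⟨X, rfl⟩ := h.surjective_fderiv hk hp W
  rw [herm_sub_left, sub_re, h.herm_re p hp, herm_euler_re k hp, herm_euler_re k (h.mapsTo hp),
    h.levelDeriv_comp hk hp, sub_self]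

lemma contDiffAt_fderiv_fderiv (h : IsMetricMap k φ) (hp : p ∈ domain) :
    ContDiffAt ℝ ∞ (fderiv ℝ (fderiv ℝ φ)) p :=
  (h.contDiffAt_fderiv hp).fderiv_right (by simp)

/-- A metric map sends fibres to fibres, linearly. -/
lemma fderiv_zeroSection (hk : 0 < k) (h : IsMetricMap k φ) {z : ℂ} (hz : 0 < z.im) (w : ℂ) :
    fderiv ℝ φ (z, 0) (0, w) = (0, (φ (z, w)).2) ∧ (φ (z, w)).1 = (φ (z, 0)).1 ∧
      (φ (z, 0)).2 = 0 := by
  have mem : ∀ r : ℝ, (z, (r : ℂ) * w) ∈ domain := fun r => hz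
  have path : ∀ r : ℝ, HasDerivAt (fun r : ℝ => (z, (r : ℂ) * w)) (0, w) r := fun r =>
    (hasDerivAt_const r z).prodMk (by simpa using (hasDerivAt_id r).ofReal_comp.mul_const w)
  have dφ : ∀ r : ℝ, HasDerivAt (fun r : ℝ => φ (z, (r : ℂ) * w))
      (fderiv ℝ φ (z, (r : ℂ) * w) (0, w)) r := fun r =>
    (h.hasFDerivAt (mem r)).comp_hasDerivAt r (path r)
  have ddφ : ∀ r : ℝ, HasDerivAt (fun r : ℝ => fderiv ℝ φ (z, (r : ℂ) * w) (0, w))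
      (fderiv ℝ (fderiv ℝ φ) (z, (r : ℂ) * w) (0, w) (0, w)) r := fun r => by
    have c : HasDerivAt (fun r : ℝ => fderiv ℝ φ (z, (r : ℂ) * w))
        (fderiv ℝ (fderiv ℝ φ) (z, (r : ℂ) * w) (0, w)) r :=
      (h.hasFDerivAt_fderiv (mem r)).comp_hasDerivAt r (path r)
    simpa only [map_zero, add_zero] using c.clm_apply (hasDerivAt_const r ((0, w) : ℂ × ℂ))
  -- On the ray r ↦ (z, rw) the Euler field is r times the velocity, so its invariance is a
  -- differential equation for φ along the ray.
  have euler : ∀ r : ℝ, r • fderiv ℝ φ (z, (r : ℂ) * w) (0, w) = (0, (φ (z, (r : ℂ) * w)).2) :=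
    fun r => by
      rw [← h.fderiv_euler hk (mem r), ← map_smul]
      simp
  have zero_of_ne : ∀ r : ℝ, r ≠ 0 →
      fderiv ℝ (fderiv ℝ φ) (z, (r : ℂ) * w) (0, w) (0, w) = 0 := fun r hr => by
    have e1 := (ddφ r).id_smul
    have e2 : HasDerivAt (fun r : ℝ => ((0 : ℂ), (φ (z, (r : ℂ) * w)).2))
      (0, (fderiv ℝ φ (z, (r : ℂ) * w) (0, w)).2) r :=
      (hasDerivAt_const r 0).prodMk (dφ r).snd_comp
    have e3 := e1.unique (e2.congr_of_eventuallyEq (Filter.Eventually.of_forall euler))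
    have h1 : (fderiv ℝ φ (z, (r : ℂ) * w) (0, w)).1 = 0 := by
      simpa [hr] using congrArg Prod.fst (euler r)
    have e4 : r • fderiv ℝ (fderiv ℝ φ) (z, (r : ℂ) * w) (0, w) (0, w) = 0 := by
      rw [← eq_sub_iff_add_eq] at e3
      rw [e3]
      exact Prod.ext (by simp [h1]) (by simp)
    exact (smul_eq_zero.mp e4).resolve_left hr
  -- The differential equation degenerates at r = 0; continuity of the second derivative fills in
  -- that value.
  have cont : Continuous fun r : ℝ => fderiv ℝ (fderiv ℝ φ) (z, (r : ℂ) * w) (0, w) (0, w) := by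
    refine (Continuous.clm_apply (Continuous.clm_apply ?_ continuous_const) continuous_const)
    refine continuous_iff_continuousAt.mpr fun r => ?_
    exact ContinuousAt.comp (f := fun r : ℝ => (z, (r : ℂ) * w))
      (h.contDiffAt_fderiv_fderiv (mem r)).continuousAt (path r).continuousAt
  have zero : ∀ r : ℝ, fderiv ℝ (fderiv ℝ φ) (z, (r : ℂ) * w) (0, w) (0, w) = 0 := fun r =>
    congrFun (cont.ext_on (dense_compl_singleton (0 : ℝ)) continuous_const
      fun r hr => zero_of_ne r hr) r
  have const : ∀ r : ℝ, fderiv ℝ φ (z, (r : ℂ) * w) (0, w) = (0, (φ (z, w)).2) := fun r => by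
    have := is_const_of_deriv_eq_zero (fun r => (ddφ r).differentiableAt)
      (fun r => (ddφ r).deriv.trans (zero r)) r 1
    rw [this]
    simpa using euler 1
  refine ⟨by simpa using const 0, ?_, ?_⟩
  · have := is_const_of_deriv_eq_zero (fun r => (dφ r).fst_comp.differentiableAt)
      (fun r => (dφ r).fst_comp.deriv.trans (by rw [const r])) 1 0
    simpa using this
  · simpa using (congrArg Prod.snd (euler 0)).symm

end IsMetricMap

/-! ### Conformal maps of the half-plane and the Schwarz lemma -/

/-- A conformal real-linear map of `ℂ` is complex linear or antilinear. -/
lemma sq_eq_of_conformal {M : ℂ →L[ℝ] ℂ} {c : ℝ} (hc : 0 < c)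
    (h : ∀ ζ, normSq (M ζ) = c * normSq ζ) : M I ^ 2 = (I * M 1) ^ 2 := by
  have h1 := h 1
  have h2 := h I
  have h3 := h (1 + I)
  rw [map_add, normSq_add] at h3
  simp only [map_one, normSq_I, mul_one] at h1 h2
  have h4 : normSq (1 + I) = 2 := by simp [normSq_apply]; norm_num
  have h5 : (M 1 * conj (M I)).re = 0 := by rw [h4] at h3; linarith
  have h6 : M 1 * conj (M I) + conj (M 1) * M I = 0 := by
    have : conj (M 1) * M I = conj (M 1 * conj (M I)) := by simp
    rw [this, add_conj, h5]
    simp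
  have h7 : M 1 * conj (M 1) = M I * conj (M I) := by
    rw [mul_conj, mul_conj, h1, h2]
  have h8 : conj (M 1) ≠ 0 := by
    rw [Ne, map_eq_zero, ← normSq_eq_zero, h1]
    exact hc.ne'
  refine mul_right_cancel₀ h8 ?_
  rw [mul_pow, I_sq]
  linear_combination (M I) * h6 + (M 1) * h7

/-- A continuous family of conformal maps over the half-plane is holomorphic or antiholomorphic. -/
lemma linear_or_antilinear {M : ℂ → ℂ →L[ℝ] ℂ} {c : ℂ → ℝ} (hM : ContinuousOn M {z | 0 < z.im})
    (hc : ∀ z, 0 < z.im → 0 < c z)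
    (h : ∀ z, 0 < z.im → ∀ ζ, normSq (M z ζ) = c z * normSq ζ) :
    (∀ z, 0 < z.im → M z I = I * M z 1) ∨ (∀ z, 0 < z.im → M z I = -(I * M z 1)) := by
  have hS : IsPreconnected {z : ℂ | 0 < z.im} := (convex_halfSpace_im_gt 0).isPreconnected
  have h0 : ∀ z, 0 < z.im → M z 1 ≠ 0 := fun z hz => by
    rw [Ne, ← normSq_eq_zero, h z hz]
    simpa using (hc z hz).ne'
  -- Pointwise the two sides agree up to sign; on the connected half-plane, continuity and
  -- nonvanishing make the sign global.
  exact hS.eq_or_eq_neg_of_sq_eq (hM.clm_apply continuousOn_const)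
    (continuousOn_const.mul (hM.clm_apply continuousOn_const))
    (fun z hz => sq_eq_of_conformal (hc z hz) (h z hz))
    (fun hz => mul_ne_zero I_ne_zero (h0 _ hz))

lemma apply_eq_of_linear {M : ℂ →L[ℝ] ℂ} (h : M I = I * M 1) (ζ : ℂ) : M ζ = M 1 * ζ := by
  conv_lhs => rw [← re_add_im ζ, ← mul_one (ζ.re : ℂ), ← real_smul, ← real_smul, map_add, map_smul,
    map_smul, h, real_smul, real_smul]
  conv_rhs => rw [← re_add_im ζ]
  ring

lemma apply_eq_of_antilinear {M : ℂ →L[ℝ] ℂ} (h : M I = -(I * M 1)) (ζ : ℂ) :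
    M ζ = M 1 * conj ζ := by
  conv_lhs => rw [← re_add_im ζ, ← mul_one (ζ.re : ℂ), ← real_smul, ← real_smul, map_add, map_smul,
    map_smul, h, real_smul, real_smul]
  conv_rhs => rw [← re_add_im ζ, map_add, map_mul, conj_I, conj_ofReal, conj_ofReal]
  ring

lemma norm_cayley_lt_one {z : ℂ} (hz : 0 < z.im) : ‖(z - I) / (z + I)‖ < 1 := by
  have h1 : z + I ≠ 0 := fun h => by
    have := congrArg im h
    simp at this
    linarith
  rw [norm_div, div_lt_one (norm_pos_iff.mpr h1), ← sq_lt_sq₀ (norm_nonneg _) (norm_nonneg _),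
    ← normSq_eq_norm_sq, ← normSq_eq_norm_sq, normSq_apply, normSq_apply]
  simp only [sub_re, I_re, sub_im, I_im, add_re, add_im]
  nlinarith

lemma cayley_symm_im_pos {ζ : ℂ} (hζ : ‖ζ‖ < 1) : 0 < (I * (1 + ζ) / (1 - ζ)).im := by
  have h1 : 1 - ζ ≠ 0 := fun h => by
    rw [← sub_eq_zero.mp h] at hζ
    simp at hζ
  have h2 : normSq ζ < 1 := by
    rw [normSq_eq_norm_sq]
    nlinarith [norm_nonneg ζ]
  have h3 : (I * (1 + ζ) / (1 - ζ)).im = (1 - normSq ζ) / normSq (1 - ζ) := by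
    rw [div_im, normSq_apply ζ]
    simp only [mul_im, mul_re, I_re, I_im, add_re, add_im, one_re, one_im, sub_re, sub_im]
    field_simp
    ring
  rw [h3]
  exact div_pos (by linarith) (normSq_pos.mpr h1)

/-- A holomorphic self-map of the half-plane with the 1-jet of the identity at `i` is the
identity. -/
lemma eq_id_of_deriv_eq_one {a : ℂ → ℂ} (ha : DifferentiableOn ℂ a {z | 0 < z.im})
    (hmaps : ∀ z, 0 < z.im → 0 < (a z).im) (haI : a I = I) (hd : HasDerivAt a 1 I) {z : ℂ}
    (hz : 0 < z.im) : a z = z := by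
  set B : ℂ → ℂ := fun ζ => I * (1 + ζ) / (1 - ζ) with hB
  set C : ℂ → ℂ := fun z => (z - I) / (z + I) with hC
  have hne : ∀ z : ℂ, 0 < z.im → z + I ≠ 0 := fun z hz h => by
    have := congrArg im h
    simp at this
    linarith
  have hne' : ∀ ζ : ℂ, ‖ζ‖ < 1 → 1 - ζ ≠ 0 := fun ζ hζ h => by
    rw [← sub_eq_zero.mp h] at hζ
    simp at hζ
  have hBC : ∀ z : ℂ, 0 < z.im → B (C z) = z := fun z hz => by
    have h1 := hne z hz
    have h2 : 1 - C z ≠ 0 := hne' _ (norm_cayley_lt_one hz)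
    have h3 : 1 - C z = 2 * I / (z + I) := by simp only [hC]; field_simp; ring
    simp only [hB, h3]
    simp only [hC]
    field_simp
    ring
  have dB : ∀ ζ : ℂ, ‖ζ‖ < 1 → HasDerivAt B (2 * I / (1 - ζ) ^ 2) ζ := fun ζ hζ => by
    have h1 := hne' ζ hζ
    refine ((((hasDerivAt_id' ζ).const_add 1).const_mul I).div
      ((hasDerivAt_id' ζ).const_sub 1) h1).congr_deriv ?_
    field_simp
    ring
  have dC : ∀ z : ℂ, 0 < z.im → HasDerivAt C (2 * I / (z + I) ^ 2) z := fun z hz => by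
    have h1 := hne z hz
    refine (((hasDerivAt_id' z).sub_const I).div
      ((hasDerivAt_id' z).add_const I) h1).congr_deriv ?_
    field_simp
    ring
  have hB0 : B 0 = I := by simp [hB]
  have hCI : C I = 0 := by simp [hC]
  set g : ℂ → ℂ := C ∘ a ∘ B with hg
  have hS : IsOpen {z : ℂ | 0 < z.im} := isOpen_lt continuous_const continuous_im
  have hgd : DifferentiableOn ℂ g (Metric.ball 0 1) := fun ζ hζ => by
    have hζ' : ‖ζ‖ < 1 := by simpa using hζ
    have hBζ := cayley_symm_im_pos hζ'
    exact (((dC _ (hmaps _ hBζ)).differentiableAt.comp ζ ((ha.differentiableAt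
      (hS.mem_nhds hBζ)).comp ζ (dB ζ hζ').differentiableAt))).differentiableWithinAt
  have hgm : Set.MapsTo g (Metric.ball 0 1) (Metric.ball (g 0) 1) := fun ζ hζ => by
    have hζ' : ‖ζ‖ < 1 := by simpa using hζ
    have : g 0 = 0 := by simp [hg, hB0, haI, hCI]
    rw [this, mem_ball_zero_iff]
    exact norm_cayley_lt_one (hmaps _ (cayley_symm_im_pos hζ'))
  have hg' : HasDerivAt g 1 0 := by
    have e1 := dB 0 (by simp)
    have e2 : HasDerivAt a 1 (B 0) := by rwa [hB0]
    have e3 := dC (a (B 0)) (by rw [hB0, haI]; simp)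
    refine (e3.comp (0 : ℂ) (e2.comp (0 : ℂ) e1)).congr_deriv ?_
    rw [hB0, haI]
    field_simp
    norm_num [I_sq]
  -- Equality case of the Schwarz lemma: in the disc model g fixes 0 and g'(0) = 1 attains the
  -- bound, so g is affine, hence the identity.
  have key := affine_of_mapsTo_ball_of_norm_dslope_eq_div hgd
    (hgm.mono_right Metric.ball_subset_closedBall) (z₀ := 0) (by simp)
    (by rw [dslope_same, hg'.deriv]; simp)
  have hCz : C z ∈ Metric.ball (0 : ℂ) 1 := mem_ball_zero_iff.mpr (norm_cayley_lt_one hz)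
  have := key hCz
  rw [dslope_same, hg'.deriv] at this
  have h2 : C (a z) = C z := by
    simpa [hg, hB0, haI, hCI, hBC z hz] using this
  rw [← hBC _ (hmaps z hz), h2, hBC z hz]

/-! ### The model isometries in coordinates -/

/-- The automorphy factor `c z + d`. -/
def autFactor (P : SL(2, ℝ)) (z : ℂ) : ℂ := ((P 1 0 : ℝ) : ℂ) * z + ((P 1 1 : ℝ) : ℂ)

/-- The action of `SL(2, ℝ)` in coordinates. -/
def slMap (P : SL(2, ℝ)) (p : ℂ × ℂ) : ℂ × ℂ :=
  ((((P 0 0 : ℝ) : ℂ) * p.1 + ((P 0 1 : ℝ) : ℂ)) / autFactor P p.1, autFactor P p.1 ^ 3 * p.2)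

/-- The circle action in coordinates. -/
def rotMap (θ : ℝ) (p : ℂ × ℂ) : ℂ × ℂ := (p.1, exp (θ * I) * p.2)

/-- The reflection `(z, w) ↦ (-z̄, w̄)` in coordinates. -/
def conjMap (p : ℂ × ℂ) : ℂ × ℂ := (-conj p.1, conj p.2)

lemma det_eq_one (P : SL(2, ℝ)) : P 0 0 * P 1 1 - P 0 1 * P 1 0 = 1 := by
  rw [← Matrix.det_fin_two, P.det_coe]

lemma autFactor_ne_zero (P : SL(2, ℝ)) {z : ℂ} (hz : 0 < z.im) : autFactor P z ≠ 0 := fun h => by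
  have h1 := congrArg im h
  have h2 := congrArg re h
  simp only [autFactor, add_im, mul_im, ofReal_re, ofReal_im, zero_mul, add_zero, zero_im,
    mul_eq_zero, hz.ne', or_false] at h1
  simp only [autFactor, h1, ofReal_zero, zero_mul, zero_add, ofReal_re, zero_re] at h2
  have := det_eq_one P
  rw [h1, h2] at this
  simp at this

lemma slMap_im (P : SL(2, ℝ)) {p : ℂ × ℂ} (hp : p ∈ domain) :
    (slMap P p).1.im = p.1.im / normSq (autFactor P p.1) := by
  have h := normSq_pos.mpr (autFactor_ne_zero P hp)
  have hd := det_eq_one P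
  simp only [slMap, div_im]
  simp only [autFactor, add_im, mul_im, add_re, mul_re, ofReal_re, ofReal_im] at h ⊢
  field_simp
  linear_combination p.1.im * hd

lemma slMap_mem (P : SL(2, ℝ)) {p : ℂ × ℂ} (hp : p ∈ domain) : slMap P p ∈ domain := by
  show 0 < (slMap P p).1.im
  rw [slMap_im P hp]
  exact div_pos hp (normSq_pos.mpr (autFactor_ne_zero P hp))

lemma slMap_mul (P Q : SL(2, ℝ)) {p : ℂ × ℂ} (hp : p ∈ domain) :
    slMap (P * Q) p = slMap P (slMap Q p) := by
  have h1 := autFactor_ne_zero Q hp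
  have h2 := autFactor_ne_zero P (slMap_mem Q hp)
  have h3 : autFactor (P * Q) p.1 = autFactor P (slMap Q p).1 * autFactor Q p.1 := by
    simp only [slMap, autFactor, Matrix.SpecialLinearGroup.coe_mul, Matrix.mul_apply,
      Fin.sum_univ_two, ofReal_add, ofReal_mul] at h1 ⊢
    field_simp
    ring
  refine Prod.ext ?_ ?_
  · show _ / autFactor (P * Q) p.1 = (_ * (slMap Q p).1 + _) / autFactor P (slMap Q p).1
    rw [h3, div_eq_div_iff (mul_ne_zero h2 h1) h2]
    simp only [slMap, Matrix.SpecialLinearGroup.coe_mul, Matrix.mul_apply,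
      Fin.sum_univ_two, ofReal_add, ofReal_mul]
    field_simp
    simp only [autFactor]
    ring
  · show autFactor (P * Q) p.1 ^ 3 * p.2 =
      autFactor P (slMap Q p).1 ^ 3 * (autFactor Q p.1 ^ 3 * p.2)
    rw [h3]
    ring

lemma slMap_one (p : ℂ × ℂ) : slMap 1 p = p := by
  simp [slMap, autFactor]

lemma slMap_inv_slMap (P : SL(2, ℝ)) {p : ℂ × ℂ} (hp : p ∈ domain) :
    slMap P⁻¹ (slMap P p) = p := by
  rw [← slMap_mul _ _ hp, inv_mul_cancel, slMap_one]

/-- The form depends only on the level, the hyperbolic product of the base components and the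
weighted product of the vertical parts, so invariance can be checked on these three. -/
lemma herm_congr {k : ℝ} {p q X Y X' Y' : ℂ × ℂ} (hl : level q = level p)
    (h1 : X'.1 * conj Y'.1 / (q.1.im : ℂ) ^ 2 = X.1 * conj Y.1 / (p.1.im : ℂ) ^ 2)
    (h2 : (q.1.im : ℂ) ^ 3 * (vert q X' * conj (vert q Y')) =
      (p.1.im : ℂ) ^ 3 * (vert p X * conj (vert p Y))) :
    herm k q X' Y' = herm k p X Y := by
  simp only [herm, hl]
  linear_combination (1 + k * level p) * h1 - 4 / 3 * k * h2

lemma fderiv_eq_of_hasDerivAt {φ : ℂ × ℂ → ℂ × ℂ} {p X V : ℂ × ℂ} (hφ : ContDiffAt ℝ ∞ φ p)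
    (h : HasDerivAt (fun s : ℝ => φ (p + s • X)) V 0) : fderiv ℝ φ p X = V :=
  ((hφ.differentiableAt (by simp)).hasFDerivAt.hasDerivAt_line X).unique h

lemma contDiffAt_slMap (P : SL(2, ℝ)) {p : ℂ × ℂ} (hp : p ∈ domain) :
    ContDiffAt ℝ ∞ (slMap P) p := by
  have h1 : ContDiffAt ℝ ∞ (fun p : ℂ × ℂ => autFactor P p.1) p :=
    (contDiffAt_const.mul contDiffAt_fst).add contDiffAt_const
  have h2 : ContDiffAt ℝ ∞
      (fun p : ℂ × ℂ => (((P 0 0 : ℝ) : ℂ) * p.1 + ((P 0 1 : ℝ) : ℂ)) / autFactor P p.1) p := by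
    simp only [div_eq_mul_inv]
    exact ((contDiffAt_const.mul contDiffAt_fst).add contDiffAt_const).mul
      (h1.inv (autFactor_ne_zero P hp))
  exact h2.prodMk ((h1.pow 3).mul contDiffAt_snd)

lemma fderiv_slMap (P : SL(2, ℝ)) {p : ℂ × ℂ} (hp : p ∈ domain) (X : ℂ × ℂ) :
    fderiv ℝ (slMap P) p X = (X.1 / autFactor P p.1 ^ 2,
      autFactor P p.1 ^ 3 * X.2 + 3 * (P 1 0 : ℝ) * autFactor P p.1 ^ 2 * X.1 * p.2) := by
  refine fderiv_eq_of_hasDerivAt (contDiffAt_slMap P hp) ?_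
  have h0 := autFactor_ne_zero P hp
  have l1 := (hasDerivAt_line p X).fst_comp
  have l2 := (hasDerivAt_line p X).snd_comp
  have n1 := (l1.const_mul ((P 0 0 : ℝ) : ℂ)).add_const ((P 0 1 : ℝ) : ℂ)
  have n2 : HasDerivAt (fun s : ℝ => autFactor P (p + s • X).1) ((P 1 0 : ℝ) * X.1) 0 :=
    (l1.const_mul ((P 1 0 : ℝ) : ℂ)).add_const ((P 1 1 : ℝ) : ℂ)
  refine ((n1.div n2 (by simpa using h0)).prodMk ((n2.pow 3).mul l2)).congr_deriv ?_
  have hd : ((P 0 0 : ℝ) : ℂ) * (P 1 1 : ℝ) - (P 0 1 : ℝ) * (P 1 0 : ℝ) = 1 := by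
    exact_mod_cast congrArg ofReal (det_eq_one P)
  simp only [zero_smul, add_zero, Pi.pow_apply]
  ext
  · simp only
    field_simp
    simp only [autFactor]
    linear_combination X.1 * hd
  · simp only
    push_cast
    ring

lemma isMetricMap_slMap (k : ℝ) (P : SL(2, ℝ)) : IsMetricMap k (slMap P) where
  contDiffOn p hp := (contDiffAt_slMap P hp).contDiffWithinAt
  mapsTo p hp := slMap_mem P hp
  herm_re p hp X Y := by
    have h0 : (p.1.im : ℂ) ≠ 0 := by exact_mod_cast (show 0 < p.1.im from hp).ne'
    have hj := autFactor_ne_zero P hp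
    have hj' : conj (autFactor P p.1) ≠ 0 := by simpa using hj
    have him : ((slMap P p).1.im : ℂ) = p.1.im / (autFactor P p.1 * conj (autFactor P p.1)) := by
      rw [slMap_im P hp, ofReal_div, mul_conj]
    -- Equivariance of the Chern connection: the vertical part transforms like the fibre coordinate,
    -- by (cz + d)³, without the derivative of this factor.
    have hv : ∀ X, vert (slMap P p) (fderiv ℝ (slMap P) p X) =
        autFactor P p.1 ^ 3 * vert p X := fun X => by
      have hc : 2 * I * p.1.im * (P 1 0 : ℝ) = autFactor P p.1 - conj (autFactor P p.1) := by
        simp only [autFactor, map_add, map_mul, conj_ofReal, im_eq_sub_conj]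
        field_simp
        ring
      simp only [vert, fderiv_slMap P hp, him]
      simp only [slMap]
      field_simp
      rw [← sub_eq_zero]
      have hI := I_sq
      generalize autFactor P p.1 = j at *
      generalize conj j = j' at *
      grind
    congr 1
    refine herm_congr ?_ ?_ ?_
    · simp only [level, him]
      simp only [slMap, map_mul, map_pow]
      field_simp
    · simp only [him, fderiv_slMap P hp, map_div₀, map_pow]
      field_simp
    · simp only [him, hv, map_mul, map_pow]
      field_simp

/-- The map is antiholomorphic and carries the form to its conjugate, which has the same real part.
-/
lemma isMetricMap_conjMap (k : ℝ) : IsMetricMap k conjMap := by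
  have hs : ContDiff ℝ ∞ conjMap :=
    ((conjCLE.contDiff.comp contDiff_fst).neg).prodMk (conjCLE.contDiff.comp contDiff_snd)
  refine ⟨hs.contDiffOn, fun p hp => by simpa [domain, conjMap] using! hp, fun p hp X Y => ?_⟩
  have hd : ∀ X, fderiv ℝ conjMap p X = conjMap X := fun X =>
    fderiv_eq_of_hasDerivAt hs.contDiffAt
      ((hasDerivAt_line p X).fst_comp.conj_comp.neg.prodMk (hasDerivAt_line p X).snd_comp.conj_comp)
  have hv : ∀ X, vert (conjMap p) (conjMap X) = conj (vert p X) := fun X => by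
    simp only [vert, conjMap, map_sub, map_mul, map_div₀, conj_I, conj_ofReal, map_ofNat, neg_im,
      conj_im, neg_neg]
    ring
  rw [hd, hd, ← conj_re (herm k p X Y), conj_herm]
  congr 1
  refine herm_congr ?_ ?_ ?_
  · simp [level, conjMap, mul_comm]
  · simp [conjMap, mul_comm]
  · simp only [hv, conj_conj]
    simp [conjMap, mul_comm]

lemma isMetricMap_rotMap (k θ : ℝ) : IsMetricMap k (rotMap θ) := by
  have hs : ContDiff ℝ ∞ (rotMap θ) := contDiff_fst.prodMk (contDiff_const.mul contDiff_snd)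
  refine ⟨hs.contDiffOn, fun p hp => hp, fun p hp X Y => ?_⟩
  have hd : ∀ X, fderiv ℝ (rotMap θ) p X = rotMap θ X := fun X =>
    fderiv_eq_of_hasDerivAt hs.contDiffAt
      ((hasDerivAt_line p X).fst_comp.prodMk ((hasDerivAt_line p X).snd_comp.const_mul _))
  have hv : ∀ X, vert (rotMap θ p) (rotMap θ X) = exp (θ * I) * vert p X := fun X => by
    simp only [vert, rotMap]
    ring
  have he : exp (θ * I) * conj (exp (θ * I)) = 1 := by
    rw [mul_conj, normSq_eq_norm_sq, norm_exp_ofReal_mul_I]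
    simp
  rw [hd, hd]
  congr 1
  refine herm_congr ?_ rfl ?_
  · simp only [level, rotMap, map_mul]
    linear_combination (p.1.im : ℂ) ^ 3 * (p.2 * conj p.2) * he
  · simp only [hv, map_mul]
    simp only [rotMap]
    linear_combination (p.1.im : ℂ) ^ 3 * (vert p X * conj (vert p Y)) * he

namespace IsMetricMap

variable {k : ℝ} {φ ψ : ℂ × ℂ → ℂ × ℂ}

lemma fderiv_comp (hψ : IsMetricMap k ψ) (hφ : IsMetricMap k φ) {p : ℂ × ℂ} (hp : p ∈ domain) :
    fderiv ℝ (ψ ∘ φ) p = (fderiv ℝ ψ (φ p)).comp (fderiv ℝ φ p) :=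
  ((hψ.hasFDerivAt (hφ.mapsTo hp)).comp p (hφ.hasFDerivAt hp)).fderiv

lemma comp (hψ : IsMetricMap k ψ) (hφ : IsMetricMap k φ) : IsMetricMap k (ψ ∘ φ) where
  contDiffOn := hψ.contDiffOn.comp hφ.contDiffOn hφ.mapsTo
  mapsTo := hψ.mapsTo.comp hφ.mapsTo
  herm_re p hp X Y := by
    rw [hψ.fderiv_comp hφ hp]
    exact (hψ.herm_re _ (hφ.mapsTo hp) _ _).trans (hφ.herm_re p hp X Y)

end IsMetricMap

/-! ### Classification of the metric maps -/

namespace IsMetricMap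

variable {k : ℝ} {φ : ℂ × ℂ → ℂ × ℂ}

/-- The differential along the zero section of the induced map of the half-plane. -/
def baseDeriv (φ : ℂ × ℂ → ℂ × ℂ) (z : ℂ) : ℂ →L[ℝ] ℂ :=
  (ContinuousLinearMap.fst ℝ ℂ ℂ).comp
    ((fderiv ℝ φ (z, 0)).comp (ContinuousLinearMap.inl ℝ ℂ ℂ))

/-- The linear map that a metric map induces on the fibre over `z`. -/
def fibreMap (φ : ℂ × ℂ → ℂ × ℂ) (z : ℂ) : ℂ →L[ℝ] ℂ :=
  (ContinuousLinearMap.snd ℝ ℂ ℂ).comp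
    ((fderiv ℝ φ (z, 0)).comp (ContinuousLinearMap.inr ℝ ℂ ℂ))

lemma continuousOn_fderiv_zero (h : IsMetricMap k φ) :
    ContinuousOn (fun z : ℂ => fderiv ℝ φ (z, 0)) {z | 0 < z.im} := fun z hz =>
  (ContinuousAt.comp (f := fun z : ℂ => (z, (0 : ℂ)))
    (h.contDiffAt_fderiv (p := (z, 0)) hz).continuousAt (by fun_prop)).continuousWithinAt

lemma continuousOn_baseDeriv (h : IsMetricMap k φ) :
    ContinuousOn (baseDeriv φ) {z | 0 < z.im} :=
  continuousOn_const.clm_comp (h.continuousOn_fderiv_zero.clm_comp continuousOn_const)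

lemma continuousOn_fibreMap (h : IsMetricMap k φ) :
    ContinuousOn (fibreMap φ) {z | 0 < z.im} :=
  continuousOn_const.clm_comp (h.continuousOn_fderiv_zero.clm_comp continuousOn_const)

lemma fibreMap_apply (hk : 0 < k) (h : IsMetricMap k φ) {z : ℂ} (hz : 0 < z.im) (w : ℂ) :
    fibreMap φ z w = (φ (z, w)).2 := by
  show (fderiv ℝ φ (z, 0) (0, w)).2 = _
  rw [(h.fderiv_zeroSection hk hz w).1]

lemma base_im_pos (h : IsMetricMap k φ) {z : ℂ} (hz : 0 < z.im) : 0 < (φ (z, 0)).1.im :=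
  h.mapsTo (x := (z, 0)) hz

lemma hasFDerivAt_base (h : IsMetricMap k φ) {z : ℂ} (hz : 0 < z.im) :
    HasFDerivAt (fun z : ℂ => (φ (z, 0)).1) (baseDeriv φ z) z := by
  have h1 := h.hasFDerivAt (p := (z, 0)) hz
  have h2 : HasFDerivAt (fun z : ℂ => (z, (0 : ℂ))) (ContinuousLinearMap.inl ℝ ℂ ℂ) z :=
    hasFDerivAt_prodMk_left z 0
  exact hasFDerivAt_fst.comp z (h1.comp z h2)

lemma fderiv_zero_inl_snd (hk : 0 < k) (h : IsMetricMap k φ) {z : ℂ} (hz : 0 < z.im) (ζ : ℂ) :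
    (fderiv ℝ φ (z, 0) (ζ, 0)).2 = 0 := by
  have e1 := ((h.hasFDerivAt (p := (z, 0)) hz).hasDerivAt_line (ζ, 0)).snd_comp
  refine e1.unique ((hasDerivAt_const (0 : ℝ) (0 : ℂ)).congr_of_eventuallyEq ?_)
  filter_upwards [eventually_line_mem (p := (z, 0)) hz (ζ, 0)] with s hs
  have := (h.fderiv_zeroSection (z := z + s • ζ) hk (by simpa [domain] using hs) 0).2.2
  simpa using this

/-- The induced map of the half-plane is an infinitesimal hyperbolic isometry. -/
lemma normSq_baseDeriv (hk : 0 < k) (h : IsMetricMap k φ) {z : ℂ} (hz : 0 < z.im) (ζ : ℂ) :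
    normSq (baseDeriv φ z ζ) = ((φ (z, 0)).1.im / z.im) ^ 2 * normSq ζ := by
  have h1 := h.herm_re (z, 0) hz (ζ, 0) (ζ, 0)
  have h2 : fderiv ℝ φ (z, 0) (ζ, 0) = (baseDeriv φ z ζ, 0) :=
    Prod.ext rfl (h.fderiv_zero_inl_snd hk hz ζ)
  have h3 : φ (z, 0) = ((φ (z, 0)).1, 0) := Prod.ext rfl (h.fderiv_zeroSection hk hz 0).2.2
  have h4 : ∀ a ζ : ℂ, herm k (a, 0) (ζ, 0) (ζ, 0) = ((normSq ζ / a.im ^ 2 : ℝ) : ℂ) := fun a ζ => by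
    simp only [herm, vert, level, mul_conj, mul_zero, zero_mul, sub_zero, add_zero, one_div,
      ofReal_div, ofReal_pow]
    simp [div_eq_inv_mul]
  rw [h2, h3, h4, h4, ofReal_re, ofReal_re] at h1
  have h5 := (h.base_im_pos hz).ne'
  have h6 := hz.ne'
  field_simp at h1 ⊢
  linarith

/-- Invariance of y³|w|² fixes the scale of the fibre map by the ratio of the heights. -/
lemma normSq_fibreMap (hk : 0 < k) (h : IsMetricMap k φ) {z : ℂ} (hz : 0 < z.im) (w : ℂ) :
    normSq (fibreMap φ z w) = (z.im / (φ (z, 0)).1.im) ^ 3 * normSq w := by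
  have h1 := h.realLevel_comp hk (p := (z, w)) hz
  rw [h.fibreMap_apply hk hz]
  have h5 := (h.base_im_pos hz).ne'
  simp only [realLevel, (h.fderiv_zeroSection hk hz w).2.1] at h1
  field_simp
  linarith

lemma base_linear_or_antilinear (hk : 0 < k) (h : IsMetricMap k φ) :
    (∀ z, 0 < z.im → baseDeriv φ z I = I * baseDeriv φ z 1) ∨
      (∀ z, 0 < z.im → baseDeriv φ z I = -(I * baseDeriv φ z 1)) :=
  linear_or_antilinear h.continuousOn_baseDeriv
    (c := fun z => ((φ (z, 0)).1.im / z.im) ^ 2)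
    (fun _ hz => pow_pos (div_pos (h.base_im_pos hz) hz) 2)
    (fun _ hz => h.normSq_baseDeriv hk hz)

lemma fibre_linear_or_antilinear (hk : 0 < k) (h : IsMetricMap k φ) :
    (∀ z, 0 < z.im → fibreMap φ z I = I * fibreMap φ z 1) ∨
      (∀ z, 0 < z.im → fibreMap φ z I = -(I * fibreMap φ z 1)) :=
  linear_or_antilinear h.continuousOn_fibreMap
    (c := fun z => (z.im / (φ (z, 0)).1.im) ^ 3)
    (fun _ hz => pow_pos (div_pos hz (h.base_im_pos hz)) 3)
    (fun _ hz => h.normSq_fibreMap hk hz)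

/-- The derivative of the fibre component along the section `w = 1`. -/
lemma hasFDerivAt_unitSection (h : IsMetricMap k φ) {z : ℂ} (hz : 0 < z.im) :
    HasFDerivAt (fun z : ℂ => (φ (z, 1)).2) ((ContinuousLinearMap.snd ℝ ℂ ℂ).comp
      ((fderiv ℝ φ (z, 1)).comp (ContinuousLinearMap.inl ℝ ℂ ℂ))) z :=
  hasFDerivAt_snd.comp z
    ((h.hasFDerivAt (p := (z, 1)) hz).comp z (hasFDerivAt_prodMk_left z 1))

/-- A metric map over the identity of the half-plane preserves horizontal vectors. -/
lemma fderiv_unitSection (hk : 0 < k) (h : IsMetricMap k φ)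
    (hid : ∀ z, 0 < z.im → (φ (z, 0)).1 = z) {z : ℂ} (hz : 0 < z.im) (ζ : ℂ) :
    (fderiv ℝ φ (z, 1) (ζ, 0)).2 = 3 * I / (2 * (z.im : ℂ)) * ζ * fibreMap φ z 1 -
      fibreMap φ z (3 * I / (2 * (z.im : ℂ)) * ζ) := by
  -- This value makes (ζ, η) the horizontal lift of ζ at the point (z, 1).
  set η : ℂ := 3 * I / (2 * (z.im : ℂ)) * ζ with hη
  have hz1 : ((z, 1) : ℂ × ℂ) ∈ domain := hz
  have hfst : ∀ p ∈ domain, (φ p).1 = p.1 := fun p hp =>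
    ((h.fderiv_zeroSection (z := p.1) hk hp p.2).2.1).trans (hid p.1 hp)
  have d1 : (fderiv ℝ φ (z, 1) (ζ, η)).1 = ζ := by
    have e1 := ((h.hasFDerivAt hz1).hasDerivAt_line (ζ, η)).fst_comp
    refine e1.unique ((hasDerivAt_line (z, 1) (ζ, η)).fst_comp.congr_of_eventuallyEq ?_)
    filter_upwards [eventually_line_mem hz1 (ζ, η)] with s hs
    exact hfst _ hs
  have d2 : ∀ η, (fderiv ℝ φ (z, 1) (0, η)).2 = fibreMap φ z η := fun η => by
    have e1 := ((h.hasFDerivAt hz1).hasDerivAt_line (0, η)).snd_comp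
    refine e1.unique ?_
    have e2 : HasDerivAt (fun s : ℝ => fibreMap φ z 1 + s • fibreMap φ z η) (fibreMap φ z η) 0 := by
      simpa using ((hasDerivAt_id' (0 : ℝ)).smul_const (fibreMap φ z η)).const_add (fibreMap φ z 1)
    refine e2.congr_of_eventuallyEq (Filter.Eventually.of_forall fun s => ?_)
    simp only [Prod.smul_mk, Prod.mk_add_mk, smul_zero, add_zero]
    rw [← h.fibreMap_apply hk hz, map_add, map_smul]
  have e := h.herm_re _ hz1 (ζ, η) (ζ, η)
  have hv : vert (z, 1) (ζ, η) = 0 := by simp [vert, hη]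
  have hl : level (φ (z, 1)) = level (z, 1) := by rw [level_eq, level_eq, h.realLevel_comp hk hz1]
  -- The level and the base component are unchanged, so equality of the metric leaves only the
  -- squared norm of the vertical part of the image, which must be 0.
  have hv' : vert (φ (z, 1)) (fderiv ℝ φ (z, 1) (ζ, η)) = 0 := by
    simp only [herm, hv, hl, d1, hfst _ hz1, zero_mul, mul_zero, sub_zero, sub_re,
      sub_eq_self] at e
    rw [mul_conj, ← ofReal_pow] at e
    have : (4 / 3 * (k : ℂ) * ((z.im ^ 3 : ℝ) : ℂ) *
        (normSq (vert (φ (z, 1)) (fderiv ℝ φ (z, 1) (ζ, η))) : ℂ)) =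
        ((4 / 3 * k * z.im ^ 3 * normSq (vert (φ (z, 1)) (fderiv ℝ φ (z, 1) (ζ, η))) : ℝ) : ℂ) := by
      push_cast
      ring
    rw [this, ofReal_re] at e
    have hc : 4 / 3 * k * z.im ^ 3 ≠ 0 := by positivity
    exact normSq_eq_zero.mp ((mul_eq_zero.mp e).resolve_left hc)
  have hsplit : fderiv ℝ φ (z, 1) (ζ, 0) =
      fderiv ℝ φ (z, 1) (ζ, η) - fderiv ℝ φ (z, 1) (0, η) := by
    rw [← map_sub]
    simp
  rw [vert, d1, hfst _ hz1, sub_eq_zero] at hv'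
  rw [hsplit, Prod.snd_sub, d2, hv', h.fibreMap_apply hk hz 1]
  simp only [hη]
  ring

/-- For antilinear fibre maps the section s(z) = φ(z, 1).2 would satisfy ds = (3i/y) s dx. Then s is
constant on vertical lines while its x-derivative depends on y, which is impossible for s ≠ 0; the
heights 1 and 2 already disagree. -/
lemma not_antilinear (hk : 0 < k) (h : IsMetricMap k φ)
    (hid : ∀ z, 0 < z.im → (φ (z, 0)).1 = z)
    (hanti : ∀ z, 0 < z.im → fibreMap φ z I = -(I * fibreMap φ z 1)) : False := by
  have key : ∀ z, 0 < z.im → ∀ ζ, (fderiv ℝ φ (z, 1) (ζ, 0)).2 =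
      3 * I / (2 * (z.im : ℂ)) * (ζ + conj ζ) * fibreMap φ z 1 := fun z hz ζ => by
    rw [h.fderiv_unitSection hk hid hz, apply_eq_of_antilinear (hanti z hz) (_ * ζ)]
    simp only [map_mul, map_div₀, conj_I, conj_ofReal, map_ofNat]
    ring
  have pos : ∀ x t : ℝ, 0 < ((x : ℂ) + Real.exp t * I).im := fun x t => by
    rw [add_im, ofReal_im, im_ofReal_mul, I_im, zero_add, mul_one]
    exact Real.exp_pos t
  -- Writing y = e^t parametrises the whole vertical line by ℝ.
  have vertical : ∀ x t : ℝ, (φ ((x : ℂ) + Real.exp t * I, 1)).2 = (φ ((x : ℂ) + I, 1)).2 :=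
    fun x t => by
    have d : ∀ t : ℝ, HasDerivAt (fun t : ℝ => (φ ((x : ℂ) + Real.exp t * I, 1)).2) 0 t := fun t => by
      have e1 : HasDerivAt (fun t : ℝ => (x : ℂ) + Real.exp t * I) (Real.exp t * I) t :=
        ((Real.hasDerivAt_exp t).ofReal_comp.mul_const I).const_add (x : ℂ)
      refine ((h.hasFDerivAt_unitSection (pos x t)).comp_hasDerivAt t e1).congr_deriv ?_
      refine (key _ (pos x t) (Real.exp t * I)).trans ?_
      simp only [map_mul, conj_I, conj_ofReal]
      ring
    have := is_const_of_deriv_eq_zero (fun t => (d t).differentiableAt) (fun t => (d t).deriv) t 0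
    simpa using this
  have horizontal : ∀ t : ℝ, HasDerivAt (fun x : ℝ => (φ ((x : ℂ) + Real.exp t * I, 1)).2)
      (3 * I / (Real.exp t : ℂ) * (φ ((0 : ℝ) + Real.exp t * I, 1)).2) 0 := fun t => by
    have e1 : HasDerivAt (fun x : ℝ => (x : ℂ) + Real.exp t * I) 1 0 :=
      (hasDerivAt_id' (0 : ℝ)).ofReal_comp.add_const _
    refine ((h.hasFDerivAt_unitSection (pos 0 t)).comp_hasDerivAt (0 : ℝ) e1).congr_deriv ?_
    refine (key _ (pos 0 t) 1).trans ?_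
    rw [h.fibreMap_apply hk (pos 0 t)]
    have : ((((0 : ℝ) : ℂ) + Real.exp t * I).im : ℂ) = Real.exp t := by
      simp
    rw [this, map_one]
    ring
  have h0 := horizontal 0
  have h1 := horizontal (Real.log 2)
  simp only [vertical] at h0 h1
  have e := h0.unique h1
  have hne : (φ (((0 : ℝ) : ℂ) + I, 1)).2 ≠ 0 := fun hφ => by
    have hp : 0 < (((0 : ℝ) : ℂ) + I).im := by simp
    have := h.normSq_fibreMap hk hp 1
    rw [h.fibreMap_apply hk hp, hφ, hid _ hp] at this
    simp at this
  have := mul_right_cancel₀ hne e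
  rw [Real.exp_zero, Real.exp_log two_pos] at this
  have := congrArg im this
  norm_num at this

/-- A metric map over the identity of the half-plane is a rotation of the fibres. -/
lemma eq_rotMap (hk : 0 < k) (h : IsMetricMap k φ) (hid : ∀ z, 0 < z.im → (φ (z, 0)).1 = z) :
    ∃ θ : ℝ, ∀ p ∈ domain, φ p = rotMap θ p := by
  rcases h.fibre_linear_or_antilinear hk with hlin | hanti
  swap
  · exact (h.not_antilinear hk hid hanti).elim
  have hI : 0 < I.im := by simp
  -- In the linear case the two terms of `fderiv_unitSection` cancel, so the image of the section w
  -- = 1 has constant fibre component.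
  have hconst : ∀ z, 0 < z.im → (φ (z, 1)).2 = (φ (I, 1)).2 := fun z hz => by
    have hS : Convex ℝ {z : ℂ | 0 < z.im} := convex_halfSpace_im_gt 0
    have hO : IsOpen {z : ℂ | 0 < z.im} := isOpen_lt continuous_const continuous_im
    refine hO.is_const_of_fderiv_eq_zero (𝕜 := ℝ) (f := fun z : ℂ => (φ (z, 1)).2)
      hS.isPreconnected
      (fun z hz => (h.hasFDerivAt_unitSection hz).differentiableAt.differentiableWithinAt)
      (fun z hz => ?_) hz hI
    rw [(h.hasFDerivAt_unitSection hz).fderiv]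
    refine ContinuousLinearMap.ext fun ζ => ?_
    refine (h.fderiv_unitSection hk hid hz ζ).trans ?_
    rw [apply_eq_of_linear (hlin z hz) (_ * ζ)]
    simp [mul_comm]
  have hnorm : ‖(φ (I, 1)).2‖ = 1 := by
    have := h.normSq_fibreMap hk hI 1
    rw [h.fibreMap_apply hk hI, hid _ hI, normSq_eq_norm_sq] at this
    have : ‖(φ (I, 1)).2‖ ^ 2 = 1 := by simpa using this
    nlinarith [norm_nonneg (φ (I, 1)).2]
  refine ⟨arg (φ (I, 1)).2, fun p hp => Prod.ext ?_ ?_⟩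
  · exact ((h.fderiv_zeroSection (z := p.1) hk hp p.2).2.1).trans (hid p.1 hp)
  · have h1 := h.fibreMap_apply (z := p.1) hk hp p.2
    rw [apply_eq_of_linear (hlin p.1 hp), h.fibreMap_apply hk hp, hconst p.1 hp] at h1
    have h2 := norm_mul_exp_arg_mul_I (φ (I, 1)).2
    rw [hnorm, ofReal_one, one_mul] at h2
    rw [rotMap, h2]
    exact h1.symm

/-- Every 1-jet of a conformal hyperbolic isometry is moved to that of the identity at `i`. -/
lemma _root_.TorusCubic.exists_slMap_jet {b α : ℂ} (hb : 0 < b.im) (hα : normSq α = b.im ^ 2) :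
    ∃ Q : SL(2, ℝ), (slMap Q (b, 0)).1 = I ∧ α / autFactor Q b ^ 2 = 1 := by
  have hα0 : α ≠ 0 := by
    rw [← normSq_pos, hα]
    positivity
  obtain ⟨s, hs⟩ := IsAlgClosed.exists_pow_nat_eq α⁻¹ (n := 2) two_pos
  have hs0 : s ≠ 0 := by
    rintro rfl
    simp at hs
    exact hα0 hs.symm
  have hns : normSq s * b.im = 1 := by
    have h1 : normSq s ^ 2 * b.im ^ 2 = 1 := by
      rw [← map_pow, hs, normSq_inv, hα]
      field_simp
    rw [← mul_pow] at h1
    have h2 : 0 < normSq s * b.im := mul_pos (normSq_pos.mpr hs0) hb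
    nlinarith
  -- With s² = 1/α, the rows are the real solutions of cb + d = 1/s and ab + b' = i/s, where b' is
  -- the upper right entry. Thus b goes to i, and the derivative 1/(cb + d)² = s² cancels α.
  have hdet : Matrix.det !![s.re, -(b * s).re; -s.im, (b * s).im] = 1 := by
    rw [Matrix.det_fin_two_of, ← hns, normSq_apply, mul_re, mul_im]
    ring
  have hj : autFactor ⟨_, hdet⟩ b = b.im * conj s := by
    simp only [autFactor, Matrix.of_apply, Matrix.cons_val', Matrix.cons_val_zero,
      Matrix.cons_val_one, Matrix.cons_val_fin_one]
    apply Complex.ext <;> simp <;> ring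
  have hjs : b.im * conj s * s = 1 := by
    have := congrArg ofReal hns
    rw [ofReal_mul, ← mul_conj, ofReal_one] at this
    rw [← this]
    ring
  have hj0 : (b.im : ℂ) * conj s ≠ 0 := left_ne_zero_of_mul (hjs.trans_ne one_ne_zero)
  refine ⟨⟨_, hdet⟩, ?_, ?_⟩
  · simp only [slMap, hj]
    rw [div_eq_iff hj0]
    simp only [Matrix.of_apply, Matrix.cons_val', Matrix.cons_val_zero,
      Matrix.cons_val_one, Matrix.cons_val_fin_one]
    apply Complex.ext <;> simp <;> ring
  · rw [hj]
    have : α = (s ^ 2)⁻¹ := by rw [hs, inv_inv]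
    rw [this, div_eq_one_iff_eq (pow_ne_zero 2 hj0)]
    refine inv_eq_of_mul_eq_one_right ?_
    rw [← mul_pow, mul_comm, hjs, one_pow]

/-- A metric map that is holomorphic on the half-plane. -/
lemma eq_slMap_rotMap (hk : 0 < k) (h : IsMetricMap k φ)
    (hlin : ∀ z, 0 < z.im → baseDeriv φ z I = I * baseDeriv φ z 1) :
    ∃ (P : SL(2, ℝ)) (θ : ℝ), ∀ p ∈ domain, φ p = slMap P (rotMap θ p) := by
  have hI : 0 < I.im := by simp
  have hderiv : ∀ z, 0 < z.im →
      HasDerivAt (fun z : ℂ => (φ (z, 0)).1) (baseDeriv φ z 1) z := fun z hz => by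
    rw [hasDerivAt_iff_hasFDerivAt]
    refine hasFDerivAt_of_restrictScalars ℝ (h.hasFDerivAt_base hz) ?_
    refine ContinuousLinearMap.ext fun ζ => ?_
    rw [apply_eq_of_linear (hlin z hz) ζ]
    simp [mul_comm]
  obtain ⟨Q, hQ1, hQ2⟩ := exists_slMap_jet (b := (φ (I, 0)).1) (α := baseDeriv φ I 1)
    (h.base_im_pos hI) (by simpa using h.normSq_baseDeriv hk hI 1)
  have hψ : IsMetricMap k (slMap Q ∘ φ) := (isMetricMap_slMap k Q).comp h
  have hd : ∀ z, 0 < z.im → HasDerivAt (fun z : ℂ => (slMap Q (φ (z, 0))).1)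
      (baseDeriv φ z 1 / autFactor Q (φ (z, 0)).1 ^ 2) z := fun z hz => by
    have hj := autFactor_ne_zero Q (h.base_im_pos hz)
    have n1 := ((hderiv z hz).const_mul ((Q 0 0 : ℝ) : ℂ)).add_const ((Q 0 1 : ℝ) : ℂ)
    have n2 : HasDerivAt (fun z : ℂ => autFactor Q (φ (z, 0)).1) ((Q 1 0 : ℝ) * baseDeriv φ z 1) z :=
      ((hderiv z hz).const_mul ((Q 1 0 : ℝ) : ℂ)).add_const ((Q 1 1 : ℝ) : ℂ)
    refine (n1.div n2 hj).congr_deriv ?_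
    have hdet : ((Q 0 0 : ℝ) : ℂ) * (Q 1 1 : ℝ) - (Q 0 1 : ℝ) * (Q 1 0 : ℝ) = 1 := by
      exact_mod_cast congrArg ofReal (det_eq_one Q)
    congr 1
    simp only [autFactor]
    linear_combination baseDeriv φ z 1 * hdet
  have hid : ∀ z, 0 < z.im → ((slMap Q ∘ φ) (z, 0)).1 = z := fun z hz => by
    refine eq_id_of_deriv_eq_one (a := fun z : ℂ => (slMap Q (φ (z, 0))).1)
      (fun z hz => (hd z hz).differentiableAt.differentiableWithinAt)
      (fun z hz => hψ.base_im_pos hz) ?_ ?_ hz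
    · exact hQ1
    · rw [← hQ2]
      exact hd I hI
  obtain ⟨θ, hθ⟩ := hψ.eq_rotMap hk hid
  refine ⟨Q⁻¹, θ, fun p hp => ?_⟩
  rw [← hθ p hp]
  exact (slMap_inv_slMap Q (h.mapsTo hp)).symm

/-- Classification of the metric maps. -/
theorem eq_or_eq (hk : 0 < k) (h : IsMetricMap k φ) :
    ∃ (P : SL(2, ℝ)) (θ : ℝ), (∀ p ∈ domain, φ p = slMap P (rotMap θ p)) ∨
      (∀ p ∈ domain, φ p = slMap P (rotMap θ (conjMap p))) := by
  rcases h.base_linear_or_antilinear hk with hlin | hanti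
  · obtain ⟨P, θ, hP⟩ := h.eq_slMap_rotMap hk hlin
    exact ⟨P, θ, Or.inl hP⟩
  -- Precomposing with the antiholomorphic isometry makes the base map holomorphic; as this isometry
  -- is an involution, it can be undone at the end.
  have hc := isMetricMap_conjMap k
  have hcc : ∀ p, conjMap (conjMap p) = p := fun p => by simp [conjMap]
  have hψ := h.comp hc
  have hder : ∀ z, 0 < z.im → ∀ ζ,
      baseDeriv (φ ∘ conjMap) z ζ = baseDeriv φ (-conj z) (-conj ζ) := fun z hz ζ => by
    have hz' : ((z, 0) : ℂ × ℂ) ∈ domain := hz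
    have h1 : fderiv ℝ conjMap (z, 0) (ζ, 0) = (-conj ζ, 0) := by
      refine fderiv_eq_of_hasDerivAt (hc.contDiffAt hz') ?_
      exact ((hasDerivAt_line (z, 0) (ζ, 0)).fst_comp.conj_comp.neg.prodMk
        (hasDerivAt_line (z, 0) (ζ, 0)).snd_comp.conj_comp).congr_deriv (by simp)
    have h2 : conjMap (z, 0) = (-conj z, 0) := by simp [conjMap]
    simp only [baseDeriv, h.fderiv_comp hc hz', h2, ContinuousLinearMap.comp_apply,
      ContinuousLinearMap.inl_apply, h1]
  obtain ⟨P, θ, hP⟩ := hψ.eq_slMap_rotMap hk fun z hz => by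
    rw [hder z hz, hder z hz, conj_I, neg_neg, map_one, map_neg, hanti _ (by simpa using hz)]
    ring
  refine ⟨P, θ, Or.inr fun p hp => ?_⟩
  rw [← hP _ (hc.mapsTo hp), Function.comp_apply, hcc]

end IsMetricMap

/-! ### Passage between the manifold and coordinates -/

/-- The inclusion `ℍ × ℂ → ℂ × ℂ`. -/
def incl (p : Total) : ℂ × ℂ := ((p.1 : ℂ), p.2)

/-- The inverse of `incl` on the domain. -/
def outOf (q : ℂ × ℂ) : Total := (UpperHalfPlane.ofComplex q.1, q.2)

lemma incl_mem (p : Total) : incl p ∈ domain := p.1.im_pos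

lemma incl_injective : Function.Injective incl := fun p q h => by
  have h1 := congrArg Prod.fst h
  have h2 := congrArg Prod.snd h
  exact Prod.ext (UpperHalfPlane.ext h1) h2

lemma outOf_incl (p : Total) : outOf (incl p) = p :=
  Prod.ext (UpperHalfPlane.ofComplex_apply p.1) rfl

lemma incl_outOf {q : ℂ × ℂ} (hq : q ∈ domain) : incl (outOf q) = q :=
  Prod.ext (by simp [incl, outOf, UpperHalfPlane.ofComplex_apply_of_im_pos hq]) rfl

/-- The coordinate expression of a self-map of `ℍ × ℂ`. -/
def coordExpr (h : Total → Total) : ℂ × ℂ → ℂ × ℂ := incl ∘ h ∘ outOf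

lemma coordExpr_incl (h : Total → Total) (p : Total) : coordExpr h (incl p) = incl (h p) := by
  simp [coordExpr, outOf_incl]

lemma extChartAt_eq (p : Total) : ⇑(extChartAt model p) = incl := by
  rw [extChartAt_prod]
  rfl

lemma extChartAt_symm_eq (p : Total) : ⇑(extChartAt model p).symm = outOf := by
  rw [extChartAt_prod]
  rfl

lemma range_model : Set.range model = Set.univ := by
  simp

/-- The chart at every point is `incl`, with inverse `outOf`, so one coordinate expression serves
the whole manifold. -/
lemma contMDiff_iff_coordExpr {h : Total → Total} :
    ContMDiff model model ∞ h ↔ Continuous h ∧ ContDiffOn ℝ ∞ (coordExpr h) domain := by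
  have : ∀ p, ContMDiffAt model model ∞ h p ↔
      ContinuousAt h p ∧ ContDiffAt ℝ ∞ (coordExpr h) (incl p) := fun p => by
    rw [contMDiffAt_iff, extChartAt_eq, extChartAt_eq, extChartAt_symm_eq, range_model,
      contDiffWithinAt_univ]
    rfl
  constructor
  · intro hh
    refine ⟨hh.continuous, fun q hq => ?_⟩
    rw [← incl_outOf hq]
    exact ((this _).mp (hh (outOf q))).2.contDiffWithinAt
  · rintro ⟨h1, h2⟩ p
    exact (this p).mpr ⟨h1.continuousAt, h2.contDiffAt (isOpen_domain.mem_nhds (incl_mem p))⟩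

lemma mfderiv_eq_fderiv_coordExpr {h : Total → Total} (hh : ContMDiff model model ∞ h)
    (p : Total) (X : ℂ × ℂ) :
    (mfderiv model model h p X : ℂ × ℂ) = fderiv ℝ (coordExpr h) (incl p) X := by
  have hd : MDifferentiableAt model model h p := (hh p).mdifferentiableAt (by simp)
  refine (DFunLike.congr_fun hd.mfderiv X).trans ?_
  show fderivWithin ℝ (writtenInExtChartAt model model p h) (Set.range model)
    (extChartAt model p p) X = _
  rw [range_model, fderivWithin_univ, writtenInExtChartAt, extChartAt_eq, extChartAt_eq,
    extChartAt_symm_eq]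
  rfl

/-- Expanding |vert|² produces the off-diagonal entries of the matrix and lowers the base
coefficient from 1 + kt to 1 - 2kt, which is 1 - f + 3tf'. -/
lemma metric_eq (k : ℝ) (p : Total) (X Y : ℂ × ℂ) :
    metric (fun t => -k * t) p X Y = (herm k (incl p) X Y).re := by
  have ht : 0 ≤ p.1.im ^ 3 * (p.2.re ^ 2 + p.2.im ^ 2) := by
    have := p.1.im_pos
    positivity
  have hd : derivWithin (fun t => -k * t) (Set.Ici 0) (p.1.im ^ 3 * (p.2.re ^ 2 + p.2.im ^ 2)) =
      -k := by
    have : HasDerivAt (fun t => -k * t) (-k) (p.1.im ^ 3 * (p.2.re ^ 2 + p.2.im ^ 2)) := by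
      simpa using (hasDerivAt_id' _).const_mul (-k)
    exact this.hasDerivWithinAt.derivWithin (uniqueDiffOn_Ici 0 _ ht)
  have hy : p.1.im ≠ 0 := p.1.im_pos.ne'
  have hz : (incl p).1.im = p.1.im := rfl
  have hw : (incl p).2 = p.2 := rfl
  have hl : level (incl p) = ((p.1.im ^ 3 * (p.2.re ^ 2 + p.2.im ^ 2) : ℝ) : ℂ) := by
    rw [level_eq_ofReal, hz, hw, normSq_apply]
    norm_num [sq]
  have hA : (1 + k * level (incl p)) / ((incl p).1.im : ℂ) ^ 2 =
      (((1 + k * (p.1.im ^ 3 * (p.2.re ^ 2 + p.2.im ^ 2))) / p.1.im ^ 2 : ℝ) : ℂ) := by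
    rw [hl, hz]
    push_cast
    rfl
  have hB : 4 / 3 * (k : ℂ) * ((incl p).1.im : ℂ) ^ 3 =
      ((4 / 3 * k * p.1.im ^ 3 : ℝ) : ℂ) := by
    rw [hz]
    push_cast
    rfl
  have hC : 3 * I / (2 * ((incl p).1.im : ℂ)) = ((3 / (2 * p.1.im) : ℝ) : ℂ) * I := by
    rw [hz]
    push_cast
    ring
  rw [herm, hA, hB, sub_re, re_ofReal_mul, re_ofReal_mul, vert, vert, hC, hw, mul_assoc,
    mul_assoc, mul_assoc, mul_assoc]
  simp only [metric, coords, metricMatrix, hd, Matrix.mulVec, dotProduct, Fin.sum_univ_four,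
    Matrix.of_apply, Matrix.cons_val', Matrix.cons_val, Matrix.cons_val_zero, Matrix.cons_val_one,
    Matrix.cons_val_fin_one, mul_re, mul_im, sub_re, sub_im, conj_re, conj_im, I_re, I_im,
    ofReal_re, ofReal_im]
  field_simp
  ring

lemma metric_mfderiv (k : ℝ) {h : Total → Total} (hh : ContMDiff model model ∞ h) (p : Total)
    (X Y : ℂ × ℂ) :
    metric (fun t => -k * t) (h p) (mfderiv model model h p X) (mfderiv model model h p Y) =
      (herm k (coordExpr h (incl p)) (fderiv ℝ (coordExpr h) (incl p) X)
        (fderiv ℝ (coordExpr h) (incl p) Y)).re := by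
  rw [coordExpr_incl, ← mfderiv_eq_fderiv_coordExpr hh, ← mfderiv_eq_fderiv_coordExpr hh]
  exact metric_eq k (h p) _ _

lemma Isom.isMetricMap {k : ℝ} (h : Isom (fun t => -k * t)) : IsMetricMap k (coordExpr h) where
  contDiffOn := (contMDiff_iff_coordExpr.mp h.1.contMDiff).2
  mapsTo _ _ := incl_mem _
  herm_re p hp X Y := by
    have h1 := metric_mfderiv k h.1.contMDiff (outOf p) X Y
    have h2 := (metric_eq k (outOf p) X Y).symm
    rw [incl_outOf hp] at h1 h2
    exact h1.symm.trans ((h.2 (outOf p) X Y).trans h2.symm)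

/-- A diffeomorphism whose coordinate expression is a metric map is an isometry. -/
def Isom.ofMetricMap {k : ℝ} (h : Diffeomorph model model Total Total ∞)
    (hh : IsMetricMap k (coordExpr h)) : Isom (fun t => -k * t) :=
  ⟨h, fun p X Y => (metric_mfderiv k h.contMDiff p X Y).trans
    ((hh.herm_re (incl p) (incl_mem p) X Y).trans (metric_eq k p X Y).symm)⟩

/-! ### The group of maps P ∘ e^{iθ} -/

/-- The transformation `P ∘ e^{iθ}`. -/
def twist (P : SL(2, ℝ)) (θ : ℝ) (p : Total) : Total := slAct P (rot θ p)

lemma incl_slAct (P : SL(2, ℝ)) (p : Total) : incl (slAct P p) = slMap P (incl p) := by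
  refine Prod.ext ?_ rfl
  show ((P • p.1 : ℍ) : ℂ) = _
  rw [UpperHalfPlane.coe_specialLinearGroup_apply]
  rfl

lemma incl_rot (θ : ℝ) (p : Total) : incl (rot θ p) = rotMap θ (incl p) := rfl

lemma incl_twist (P : SL(2, ℝ)) (θ : ℝ) (p : Total) :
    incl (twist P θ p) = slMap P (rotMap θ (incl p)) := by
  rw [twist, incl_slAct, incl_rot]

/-- Rotations commute with SL(2, ℝ), since the latter acts complex-linearly on the fibres; hence
these maps compose as in the product group. -/
lemma twist_twist (P Q : SL(2, ℝ)) (θ η : ℝ) (p : Total) :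
    twist P θ (twist Q η p) = twist (P * Q) (θ + η) p := by
  apply incl_injective
  have h1 : ∀ q, rotMap θ (slMap Q q) = slMap Q (rotMap θ q) := fun q => by
    simp only [rotMap, slMap]
    ext <;> simp only
    ring
  have h2 : ∀ q, rotMap θ (rotMap η q) = rotMap (θ + η) q := fun q => by
    simp only [rotMap]
    rw [← mul_assoc, ← exp_add]
    push_cast
    rw [add_mul]
  simp only [incl_twist]
  rw [h1, h2, slMap_mul]
  exact incl_mem p

lemma twist_one_zero (p : Total) : twist 1 0 p = p := by
  apply incl_injective
  rw [incl_twist, slMap_one]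
  simp [rotMap]

lemma continuous_twist :
    Continuous fun x : SL(2, ℝ) × ℝ × Total => twist x.1 x.2.1 x.2.2 := by
  have h1 : ∀ i j, Continuous fun x : SL(2, ℝ) × ℝ × Total => (x.1 i j : ℝ) := fun i j =>
    (continuous_subtype_val.comp continuous_fst).matrix_elem i j
  have h2 : Continuous fun x : SL(2, ℝ) × ℝ × Total => (x.2.2.1 : ℂ) :=
    UpperHalfPlane.continuous_coe.comp (continuous_fst.comp (continuous_snd.comp continuous_snd))
  have h3 : Continuous fun x : SL(2, ℝ) × ℝ × Total => x.1 • x.2.2.1 :=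
    continuous_fst.smul (continuous_fst.comp (continuous_snd.comp continuous_snd))
  have h4 := (((continuous_ofReal.comp (h1 1 0)).mul h2).add (continuous_ofReal.comp (h1 1 1))).pow 3
  have h5 : Continuous fun x : SL(2, ℝ) × ℝ × Total => exp (x.2.1 * I) * x.2.2.2 := by fun_prop
  exact h3.prodMk (h4.mul h5)

lemma coordExpr_twist_eqOn (P : SL(2, ℝ)) (θ : ℝ) :
    Set.EqOn (coordExpr (twist P θ)) (slMap P ∘ rotMap θ) domain := fun q hq => by
  rw [← incl_outOf hq, coordExpr_incl, incl_twist, Function.comp_apply]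

lemma contMDiff_twist (P : SL(2, ℝ)) (θ : ℝ) : ContMDiff model model ∞ (twist P θ) :=
  contMDiff_iff_coordExpr.mpr
    ⟨Continuous.comp (f := fun p : Total => (P, θ, p)) continuous_twist (by fun_prop),
      ((isMetricMap_slMap 0 P).comp (isMetricMap_rotMap 0 θ)).contDiffOn.congr
        (coordExpr_twist_eqOn P θ)⟩

lemma IsMetricMap.congr {k : ℝ} {φ ψ : ℂ × ℂ → ℂ × ℂ} (h : IsMetricMap k φ)
    (he : Set.EqOn ψ φ domain) : IsMetricMap k ψ where
  contDiffOn := h.contDiffOn.congr he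
  mapsTo := h.mapsTo.congr he.symm
  herm_re p hp X Y := by
    rw [(he.eventuallyEq_of_mem (isOpen_domain.mem_nhds hp)).fderiv_eq, he hp, h.herm_re p hp]

/-- The diffeomorphism `P ∘ e^{iθ}`. -/
def twistDiffeo (P : SL(2, ℝ)) (θ : ℝ) : Diffeomorph model model Total Total ∞ where
  toFun := twist P θ
  invFun := twist P⁻¹ (-θ)
  left_inv p := by rw [twist_twist, inv_mul_cancel, neg_add_cancel, twist_one_zero]
  right_inv p := by rw [twist_twist, mul_inv_cancel, add_neg_cancel, twist_one_zero]
  contMDiff_toFun := contMDiff_twist P θ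
  contMDiff_invFun := contMDiff_twist P⁻¹ (-θ)

/-- The isometry `P ∘ e^{iθ} ∘ h`. -/
def Isom.twist {k : ℝ} (h : Isom (fun t => -k * t)) (P : SL(2, ℝ)) (θ : ℝ) :
    Isom (fun t => -k * t) :=
  Isom.ofMetricMap (h.1.trans (twistDiffeo P θ)) <|
    (((isMetricMap_slMap k P).comp (isMetricMap_rotMap k θ)).comp h.isMetricMap).congr
      fun _ _ => incl_twist P θ _

lemma Isom.twist_apply {k : ℝ} (h : Isom (fun t => -k * t)) (P : SL(2, ℝ)) (θ : ℝ) (p : Total) :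
    h.twist P θ p = TorusCubic.twist P θ (h p) := rfl

/-- Joint continuity in the parameters and the point gives, by currying, continuity into the
compact-open topology. -/
lemma Isom.continuous_twist {k : ℝ} (h : Isom (fun t => -k * t)) :
    Continuous fun x : SL(2, ℝ) × ℝ => h.twist x.1 x.2 := by
  refine continuous_induced_rng.mpr (ContinuousMap.continuous_of_continuous_uncurry _ ?_)
  have h1 : Continuous fun x : (SL(2, ℝ) × ℝ) × Total => h x.2 :=
    h.1.continuous.comp continuous_snd
  exact Continuous.comp (f := fun x : (SL(2, ℝ) × ℝ) × Total => (x.1.1, x.1.2, h x.2))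
    TorusCubic.continuous_twist (by fun_prop)

lemma Isom.ext {k : ℝ} {h h' : Isom (fun t => -k * t)} (e : ∀ p, h p = h' p) : h = h' :=
  Subtype.ext (Diffeomorph.ext e)

lemma Isom.continuous_eval {k : ℝ} (p : Total) : Continuous fun h : Isom (fun t => -k * t) => h p := by
  have : Continuous (Isom.toContinuousMap (f := fun t => -k * t)) := continuous_induced_dom
  exact (continuous_eval_const (F := C(Total, Total)) p).comp this

lemma hasForm_iff {r h : Total → Total} :
    HasForm r h ↔ ∃ (P : SL(2, ℝ)) (θ : ℝ), ∀ p, h p = twist P θ (r p) :=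
  exists_congr fun _ => exists_congr fun _ => funext_iff

/-- Every isometry has the first or the last form. -/
lemma Isom.hasForm_or {k : ℝ} (hk : 0 < k) (h : Isom (fun t => -k * t)) :
    HasForm id h ∨ HasForm (refl₁ ∘ refl₂) h := by
  obtain ⟨P, θ, hP | hP⟩ := h.isMetricMap.eq_or_eq hk
  · refine Or.inl (hasForm_iff.mpr ⟨P, θ, fun p => incl_injective ?_⟩)
    rw [incl_twist, ← coordExpr_incl]
    exact hP _ (incl_mem p)
  · refine Or.inr (hasForm_iff.mpr ⟨P, θ, fun p => incl_injective ?_⟩)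
    rw [incl_twist, ← coordExpr_incl]
    exact hP _ (incl_mem p)

/-! ### Uniqueness of the form -/

lemma refl₁_refl₁ (p : Total) : refl₁ (refl₁ p) = p :=
  incl_injective (by simp [refl₁, incl])

lemma refl₂_refl₂ (p : Total) : refl₂ (refl₂ p) = p :=
  incl_injective (by simp [refl₂, incl])

lemma refl₂_refl₁ (p : Total) : refl₂ (refl₁ p) = refl₁ (refl₂ p) := rfl

lemma twist_snd (P : SL(2, ℝ)) (θ : ℝ) (p : Total) :
    (twist P θ p).2 = autFactor P p.1 ^ 3 * exp (θ * I) * p.2 :=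
  (mul_assoc _ _ _).symm

lemma twist_snd_ne_conj {P : SL(2, ℝ)} {θ : ℝ} (h : ∀ p, (twist P θ p).2 = conj p.2) : False := by
  have h1 := h (UpperHalfPlane.I, 1)
  have h2 := h (UpperHalfPlane.I, I)
  simp only [twist_snd, mul_one, map_one, conj_I] at h1 h2
  rw [h1, one_mul] at h2
  have := congrArg im h2
  norm_num at this

lemma twist_ne_refl₁ {P : SL(2, ℝ)} {θ : ℝ} (h : ∀ p, twist P θ p = refl₁ p) : False := by
  have key : ∀ z : ℂ, 0 < z.im →
      ((P 0 0 : ℝ) : ℂ) * z + ((P 0 1 : ℝ) : ℂ) = -conj z * autFactor P z := fun z hz => by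
    have h1 := congrArg (fun p => (incl p).1) (h (⟨z, hz⟩, 0))
    simp only [incl_twist] at h1
    exact (div_eq_iff (autFactor_ne_zero P hz)).mp h1
  -- The points i and 2i force the off-diagonal entries to vanish and the diagonal ones to agree; 1
  -- + i then makes the diagonal entries opposite, against determinant 1.
  have h1 := key I (by simp)
  have h2 := key (2 * I) (by simp)
  have h3 := key (1 + I) (by simp)
  simp only [autFactor, Complex.ext_iff] at h1 h2 h3
  simp at h1 h2 h3
  have hd := det_eq_one P
  nlinarith

/-- Two forms of one map would make r' ∘ r, an element of a Klein four-group, equal to some P ∘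
e^{iθ}. A nontrivial element either conjugates the fibre coordinate or is `refl₁`, and neither is
possible. -/
lemma eq_of_hasForm {r r' h : Total → Total}
    (hr : r ∈ ({id, refl₁, refl₂, refl₁ ∘ refl₂} : Set (Total → Total)))
    (hr' : r' ∈ ({id, refl₁, refl₂, refl₁ ∘ refl₂} : Set (Total → Total)))
    (h1 : HasForm r h) (h2 : HasForm r' h) : r = r' := by
  obtain ⟨P, θ, hP⟩ := hasForm_iff.mp h1
  obtain ⟨Q, η, hQ⟩ := hasForm_iff.mp h2
  have hT : ∀ p, twist (Q⁻¹ * P) (-η + θ) (r p) = r' p := fun p => by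
    rw [← twist_twist, ← hP, hQ, twist_twist, inv_mul_cancel, neg_add_cancel, twist_one_zero]
  have hinv : ∀ p, r (r p) = p := by
    rcases hr with rfl | rfl | rfl | rfl <;>
      simp [refl₁_refl₁, refl₂_refl₂, refl₂_refl₁]
  have hS : ∀ p, twist (Q⁻¹ * P) (-η + θ) p = r' (r p) := fun p => by
    rw [← hT, hinv]
  rcases hr with rfl | rfl | rfl | rfl <;> rcases hr' with rfl | rfl | rfl | rfl <;>
    first
    | rfl
    | exact (twist_snd_ne_conj fun p => congrArg Prod.snd (hS p)).elim
    | exact (twist_ne_refl₁ hS).elim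
    | exact (twist_ne_refl₁ fun p => (hS p).trans
        (by simp [refl₂_refl₁, refl₂_refl₂])).elim

/-! ### Connected components -/

/-- The upper unitriangular matrices. -/
def upper (a : ℝ) : SL(2, ℝ) := ⟨!![1, a; 0, 1], by simp⟩

/-- The lower unitriangular matrices. -/
def lower (a : ℝ) : SL(2, ℝ) := ⟨!![1, 0; a, 1], by simp⟩

lemma continuous_upper : Continuous upper :=
  Continuous.subtype_mk (continuous_matrix fun i j => by
    fin_cases i <;> fin_cases j <;> simp <;> fun_prop) _

lemma continuous_lower : Continuous lower :=
  Continuous.subtype_mk (continuous_matrix fun i j => by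
    fin_cases i <;> fin_cases j <;> simp <;> fun_prop) _

/-- A matrix of determinant 1 with lower left entry r ≠ 0 is upper · lower(r) · upper. A lower
factor on the right first arranges r ≠ 0, so SL(2, ℝ) is a continuous image of ℝ⁴. -/
lemma exists_eq_upper_mul_lower (P : SL(2, ℝ)) :
    ∃ a b c d, P = upper a * lower b * upper c * lower d := by
  have hd := det_eq_one P
  obtain ⟨d, hr⟩ : ∃ d, P 1 0 - P 1 1 * d ≠ 0 := by
    by_cases h : P 1 1 = 0
    · refine ⟨0, fun h0 => ?_⟩
      rw [h] at hd h0
      rw [zero_mul, sub_zero] at h0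
      rw [h0] at hd
      simp at hd
    · refine ⟨(P 1 0 - 1) / P 1 1, ?_⟩
      rw [mul_div_cancel₀ _ h]
      simp
  obtain ⟨a, ha⟩ : ∃ a, a * (P 1 0 - P 1 1 * d) = P 0 0 - P 0 1 * d - 1 :=
    ⟨_, div_mul_cancel₀ _ hr⟩
  obtain ⟨c, hc⟩ : ∃ c, c * (P 1 0 - P 1 1 * d) = P 1 1 - 1 := ⟨_, div_mul_cancel₀ _ hr⟩
  have hq : (1 + a * (P 1 0 - P 1 1 * d)) * c + a = P 0 1 := by
    refine mul_right_cancel₀ hr ?_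
    linear_combination (1 + a * (P 1 0 - P 1 1 * d)) * hc + P 1 1 * ha + hd
  refine ⟨a, P 1 0 - P 1 1 * d, c, d, Subtype.ext ?_⟩
  show P.1 = (upper a).1 * (lower _).1 * (upper c).1 * (lower d).1
  refine (Matrix.eta_fin_two P.1).trans ?_
  simp only [upper, lower, Matrix.mul_fin_two]
  congr 1
  refine congrArg₂ _ (congrArg₂ _ ?_ (congrArg₂ _ ?_ rfl))
    (congrArg₂ _ (congrArg₂ _ ?_ (congrArg₂ _ ?_ rfl)) rfl)
  · linear_combination -ha - d * hq
  · linear_combination -hq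
  · linear_combination -d * hc
  · linear_combination -hc

lemma isPreconnected_univ_SL : IsPreconnected (Set.univ : Set SL(2, ℝ)) := by
  have hc : Continuous fun x : ℝ × ℝ × ℝ × ℝ =>
      upper x.1 * lower x.2.1 * upper x.2.2.1 * lower x.2.2.2 := by
    have := continuous_upper
    have := continuous_lower
    fun_prop
  have := isPreconnected_univ.image _ hc.continuousOn
  rwa [Set.image_univ, Set.range_eq_univ.mpr] at this
  intro P
  obtain ⟨a, b, c, d, h⟩ := exists_eq_upper_mul_lower P
  exact ⟨(a, b, c, d), h.symm⟩

lemma Isom.twist_mem_connectedComponent {k : ℝ} (h : Isom (fun t => -k * t)) (P : SL(2, ℝ))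
    (θ : ℝ) : h.twist P θ ∈ connectedComponent h := by
  have h1 : IsPreconnected (Set.univ : Set (SL(2, ℝ) × ℝ)) := by
    rw [← Set.univ_prod_univ]
    exact isPreconnected_univ_SL.prod isPreconnected_univ
  have h2 := h1.image _ h.continuous_twist.continuousOn
  refine h2.subset_connectedComponent ⟨(1, 0), trivial, ?_⟩ ⟨(P, θ), trivial, rfl⟩
  exact Isom.ext fun p => twist_one_zero (h p)

/-- A continuous function whose sign distinguishes the two forms. -/
def orientation (h : Total → Total) : ℝ :=
  ((h (UpperHalfPlane.I, I)).2 * conj (h (UpperHalfPlane.I, 1)).2).im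

lemma orientation_pos {h : Total → Total} (hh : HasForm id h) : 0 < orientation h := by
  obtain ⟨P, θ, hP⟩ := hasForm_iff.mp hh
  set c := autFactor P I ^ 3 * exp (θ * I) with hc
  have hc0 : c ≠ 0 := mul_ne_zero (pow_ne_zero 3 (autFactor_ne_zero P (by simp))) (exp_ne_zero _)
  have h1 : (h (UpperHalfPlane.I, I)).2 = c * I := by rw [hP]; exact twist_snd _ _ _
  have h2 : (h (UpperHalfPlane.I, 1)).2 = c := by rw [hP]; simpa using twist_snd P θ (UpperHalfPlane.I, 1)
  have : c * I * conj c = (normSq c : ℂ) * I := by rw [← mul_conj]; ring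
  rw [orientation, h1, h2, this, im_ofReal_mul, I_im, mul_one]
  exact normSq_pos.mpr hc0

lemma orientation_neg {h : Total → Total} (hh : HasForm (refl₁ ∘ refl₂) h) : orientation h < 0 := by
  obtain ⟨P, θ, hP⟩ := hasForm_iff.mp hh
  set c := autFactor P I ^ 3 * exp (θ * I) with hc
  have hc0 : c ≠ 0 := mul_ne_zero (pow_ne_zero 3 (autFactor_ne_zero P (by simp))) (exp_ne_zero _)
  have hp : ∀ w, (refl₁ ∘ refl₂) (UpperHalfPlane.I, w) = (UpperHalfPlane.I, conj w) := fun w =>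
    incl_injective (by simp [incl, refl₁, refl₂])
  have h1 : (h (UpperHalfPlane.I, I)).2 = c * conj I := by rw [hP, hp]; exact twist_snd _ _ _
  have h2 : (h (UpperHalfPlane.I, 1)).2 = c := by
    rw [hP, hp]; simpa using twist_snd P θ (UpperHalfPlane.I, 1)
  have : c * conj I * conj c = ((-normSq c : ℝ) : ℂ) * I := by
    rw [ofReal_neg, ← mul_conj, conj_I]; ring
  rw [orientation, h1, h2, this, im_ofReal_mul, I_im, mul_one, neg_lt_zero]
  exact normSq_pos.mpr hc0

lemma continuous_orientation {k : ℝ} :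
    Continuous fun h : Isom (fun t => -k * t) => orientation h :=
  continuous_im.comp ((continuous_snd.comp (Isom.continuous_eval _)).mul
    (continuous_conj.comp (continuous_snd.comp (Isom.continuous_eval _))))

/-- Since only the first and last forms occur, the orientation never vanishes, and its positivity
set is clopen. -/
lemma orientation_pos_iff_of_mem {k : ℝ} (hk : 0 < k) {h h' : Isom (fun t => -k * t)}
    (hh : h' ∈ connectedComponent h) : 0 < orientation h' ↔ 0 < orientation h := by
  have ho : ∀ g : Isom (fun t => -k * t), ¬ 0 < orientation g ↔ orientation g < 0 := fun g => by
    rcases g.hasForm_or hk with hg | hg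
    · have := orientation_pos hg
      constructor <;> intro <;> linarith
    · have := orientation_neg hg
      constructor <;> intro <;> linarith
  have hclopen : IsClopen {g : Isom (fun t => -k * t) | 0 < orientation g} := by
    refine ⟨⟨?_⟩, isOpen_lt continuous_const continuous_orientation⟩
    have : {g : Isom (fun t => -k * t) | 0 < orientation g}ᶜ =
        {g : Isom (fun t => -k * t) | orientation g < 0} := Set.ext ho
    rw [this]
    exact isOpen_lt continuous_orientation continuous_const
  constructor
  · intro h0
    have := connectedComponent_eq hh
    exact hclopen.connectedComponent_subset (x := h') h0 (this ▸ mem_connectedComponent)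
  · intro h0
    exact hclopen.connectedComponent_subset h0 hh

lemma mem_connectedComponent_iff_hasForm {k : ℝ} (hk : 0 < k) {r : Total → Total}
    (hr : r ∈ ({id, refl₁, refl₂, refl₁ ∘ refl₂} : Set (Total → Total)))
    {h : Isom (fun t => -k * t)} (hh : HasForm r h) (h' : Isom (fun t => -k * t)) :
    h' ∈ connectedComponent h ↔ HasForm r h' := by
  constructor
  · intro hmem
    have hpos := orientation_pos_iff_of_mem hk hmem
    rcases h.hasForm_or hk with h1 | h1
    -- Uniqueness identifies r with the form that h is known to have, and the sign of the
    -- orientation excludes the other form for h'.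
    · rw [eq_of_hasForm hr (by simp) hh h1]
      refine (h'.hasForm_or hk).resolve_right fun h2 => ?_
      exact lt_asymm (orientation_neg h2) (hpos.mpr (orientation_pos h1))
    · rw [eq_of_hasForm hr (by simp) hh h1]
      refine (h'.hasForm_or hk).resolve_left fun h2 => ?_
      exact lt_asymm (orientation_neg h1) (hpos.mp (orientation_pos h2))
  · intro hh'
    obtain ⟨P, θ, hP⟩ := hasForm_iff.mp hh
    obtain ⟨Q, η, hQ⟩ := hasForm_iff.mp hh'
    -- The common reflection cancels, so h' differs from h by a left factor in the connected family.
    have : h' = h.twist (Q * P⁻¹) (η - θ) := Isom.ext fun p => by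
      rw [Isom.twist_apply, hP, hQ, twist_twist, inv_mul_cancel_right, sub_add_cancel]
    rw [this]
    exact h.twist_mem_connectedComponent _ _

lemma hasForm_id_id (k : ℝ) : HasForm id (Isom.id (fun t => -k * t)) :=
  hasForm_iff.mpr ⟨1, 0, fun p => (twist_one_zero p).symm⟩

end TorusCubic

end

theorem corollaryC (k : ℝ) (hk : 0 < k) :
    -- every isometry has one of the four forms
    (∀ h : TorusCubic.Isom (fun t => -k * t),
      TorusCubic.HasForm id h ∨ TorusCubic.HasForm TorusCubic.refl₁ h ∨
        TorusCubic.HasForm TorusCubic.refl₂ h ∨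
        TorusCubic.HasForm (TorusCubic.refl₁ ∘ TorusCubic.refl₂) h) ∧
    -- it has only one of them
    (∀ h : TorusCubic.Isom (fun t => -k * t),
      ∃! r : TorusCubic.Total → TorusCubic.Total,
        r ∈ ({id, TorusCubic.refl₁, TorusCubic.refl₂, TorusCubic.refl₁ ∘ TorusCubic.refl₂} :
          Set (TorusCubic.Total → TorusCubic.Total)) ∧ TorusCubic.HasForm r h) ∧
    -- the first form is that of the isometries in the identity component
    (∀ h : TorusCubic.Isom (fun t => -k * t),
      h ∈ connectedComponent (TorusCubic.Isom.id (fun t => -k * t)) ↔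
        TorusCubic.HasForm id h) ∧
    -- two isometries lie in the same connected component exactly if they have the same form
    (∀ r ∈ ({id, TorusCubic.refl₁, TorusCubic.refl₂, TorusCubic.refl₁ ∘ TorusCubic.refl₂} :
          Set (TorusCubic.Total → TorusCubic.Total)),
      ∀ h h' : TorusCubic.Isom (fun t => -k * t), TorusCubic.HasForm r h →
        (h' ∈ connectedComponent h ↔ TorusCubic.HasForm r h')) := by
  refine ⟨fun h => ?_, fun h => ?_, fun h => ?_, fun r hr h h' hh => ?_⟩
  · rcases h.hasForm_or hk with h1 | h1
    · exact Or.inl h1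
    · exact Or.inr (Or.inr (Or.inr h1))
  · rcases h.hasForm_or hk with h1 | h1
    · exact ⟨_, ⟨by simp, h1⟩, fun r hr => TorusCubic.eq_of_hasForm hr.1 (by simp) hr.2 h1⟩
    · exact ⟨_, ⟨by simp, h1⟩, fun r hr => TorusCubic.eq_of_hasForm hr.1 (by simp) hr.2 h1⟩
  · exact TorusCubic.mem_connectedComponent_iff_hasForm hk (by simp)
      (TorusCubic.hasForm_id_id k) h
  · exact TorusCubic.mem_connectedComponent_iff_hasForm hk hr hh h'
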